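/- **Setting.** Let $U$ be a finite universe, $m=|U|$. A stream $S$ is a finite sequence of updates $(i_1,d_1),\dots,(i_t,d_t)\in U\times\mathbb Z$ (turnstile model; the cash register model is the case where all $d_k\ge 0$). Its state vector is $a_i=\sum_{k:\,i_k=i}d_k$ and its distinct count is $D=|\{i:a_i\ne0\}|$. Say that $S$ is $Z$-bounded if $|a_i|<Z$ for all $i$. Streams $S,S'$ are *neighbours with replaced total $s$* if for some $i\neq j$ a collection of updates of $S$ to $i$ with total $s$ is replaced by a collection of updates of $S'$ to $j$ with the same total $s$, while the remaining updates of $S$ and of $S'$ have the same total for every identifier; they are *neighbours* if this holds for some $s$. A streaming algorithm is *$\varepsilon$-pan-private* (against a single intrusion) on a class of pairs of streams if for each pair $S,S'$ in the class and each measurable set $E$ of pairs (internal state, output), $\Pr[\mathrm{Alg}(S)\in E]\le e^{\varepsilon}\Pr[\mathrm{Alg}(S')\in E]$. A probability law $\nu$ on $\mathbb R$ is $p$-stable if for all $n$, all real $b_1,\dots,b_n$ and independent $Y_1,\dots,Y_n,Y\sim\nu$, $\sum_i b_iY_i$ has the law of $(\sum_i|b_i|^p)^{1/p}Y$. Let $B(p)=1/\operatorname{median}(|X_0|^p)$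 with $X_0\sim\nu$. **Algorithm.** Parameters: $\alpha>0$, $0<\varepsilon<1$, $0<\delta<1$, $0<p<\varepsilon/Z<1$, a real $W$ with $Z\le W\le 2Z$, a $p$-stable law $\nu\ne\delta_0$, and the number $r$ of sketches. Let $X\in\mathbb R^{U\times r}$ have independent entries of law $\nu$; $X$ is available to the algorithm as a read-only random table, and it counts as part of the internal state seen by an intruder. Write $\|X_j\|_\infty=\max_i|X_{i,j}|$. The memory consists of $r$ real counters. Given $X$, counter $j$ is initialised with independent Laplace noise $\eta_j\sim\mathrm{Lap}(2W\|X_j\|_\infty/\alpha)$; an update $(i,d)$ adds $d\,X_{i,j}$ to counter $j$ for every $j$. The output is $\tilde D=B(p)\cdot\operatorname{median}_j|\mathrm{counter}_j|^p$ (the $\lceil r/2\rceil$-th smallest value). Put $\alpha'=\alpha r$ and $\xi=\big(\tfrac{2W\max_j\|X_j\|_\infty}{\alpha}\log\tfrac1\delta\big)^p$. **Theorem.** There is a universal constant $C>0$ such that for every $r\ge C\varepsilon^{-2}\log(1/\delta)$ (in particular for $r=\lceil C\varepsilon^{-2}\log(1/\delta)\rceil$ counters) and all parameters as above: 1. *(Privacy.)*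 The algorithm is $\alpha'$-pan-private on $Z$-bounded neighbouring turnstile streams with replaced total at most $W$ in absolute value. Hence it is $\alpha'$-pan-private on all $Z$-bounded neighbouring turnstile streams if $W=2Z$, and on all $Z$-bounded neighbouring cash register streams for every $W\in[Z,2Z]$, in particular for $W=Z$. 2. *(Accuracy.)* For every $Z$-bounded turnstile stream $S$, with probability at least $1-(r+1)\delta$, $$(1-\varepsilon)D-\xi\,B(p)\ \le\ \tilde D\ \le\ (1+\varepsilon)D+\xi\,B(p).$$ 3. *(Size of the additive error.)* For every matrix $X$, $$\xi\,B(p)\le 4(1+\varepsilon)\,B(p)\,\big(\max_j\|X_j\|_\infty\big)^p\Big(\frac{r\log(1/\delta)}{\alpha'}\Big)^p.$$ Consequently, if $r\le K(1+\log m)^k$ with $K\ge0$, $k\in\mathbb N$, then for every $Z$-bounded turnstile stream, with probability at least $1-(r+1)\delta$, $$|\tilde D-D|\le\varepsilon D+4(1+K)\,B(p)\,\big(\max_j\|X_j\|_\infty\big)^p\,(1+\varepsilon)\,(1+\log m)^k\Big(1+\log\frac1\delta\Big)\Big(1+\frac1{\alpha'}\Big),$$ that is, $(1\pm\varepsilon)D$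 up to an additive error polynomial in $\log m$, $\log(1/\delta)$, $1/\alpha'$, where the factor $B(p)\max_j\|X_j\|_\infty^p$ is regarded as a constant. -/

import Mathlib

open MeasureTheory

/-! ### Streams, state vectors, neighbouring streams -/

/-- A (finite prefix of a) stream of updates `(i, d)`: an identifier in the universe `U` together
with an integer increment, which may be negative (turnstile model). -/
abbrev UpdateStream (U : Type*) := List (U × ℤ)

namespace UpdateStream

variable {U : Type*} [DecidableEq U]

/-- The sum of the increments of the updates of `S` at the positions in `K`. -/
def sumOn (S : UpdateStream U) (K : Finset (Fin S.length)) : ℤ :=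
  ∑ k ∈ K, (S.get k).2

/-- The sum of the increments to the identifier `i` over the positions in `K`. -/
def sumOnAt (S : UpdateStream U) (K : Finset (Fin S.length)) (i : U) : ℤ :=
  ∑ k ∈ K with (S.get k).1 = i, (S.get k).2

/-- The state vector: `a i` is the sum of all increments to `i`. -/
def stateVec (S : UpdateStream U) (i : U) : ℤ := S.sumOnAt Finset.univ i

/-- The distinct count: the number of identifiers `i` with `a i ≠ 0`. -/
def distinctCount [Fintype U] (S : UpdateStream U) : ℕ :=
  (Finset.univ.filter fun i => S.stateVec i ≠ 0).card

/-- Every entry of the state vector is smaller than `Z` in absolute value. -/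
def BoundedBy (Z : ℝ) (S : UpdateStream U) : Prop := ∀ i, |(S.stateVec i : ℝ)| < Z

/-- All increments are nonnegative (cash register model). -/
def CashRegister (S : UpdateStream U) : Prop := ∀ u ∈ S, 0 ≤ u.2

/-- `S` and `S'` are neighbours, and the updates that are replaced have total `s`: some updates `K`
of `S`, all to one identifier `i`, are replaced by updates `K'` of `S'`, all to another identifier
`j ≠ i`, with the same total `s`; the remaining updates have, identifier by identifier, the same
totals in `S` and `S'`. -/
def NeighborBy (S S' : UpdateStream U) (s : ℤ) : Prop :=
  ∃ (i j : U) (K : Finset (Fin S.length)) (K' : Finset (Fin S'.length)),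
    i ≠ j ∧ (∀ k ∈ K, (S.get k).1 = i) ∧ (∀ k ∈ K', (S'.get k).1 = j) ∧
    S.sumOn K = s ∧ S'.sumOn K' = s ∧
    ∀ l : U, S.sumOnAt Kᶜ l = S'.sumOnAt K'ᶜ l

/-- User-level neighbours. -/
def Neighbor (S S' : UpdateStream U) : Prop := ∃ s : ℤ, NeighborBy S S' s

end UpdateStream

/-! ### Streaming algorithms and pan-privacy -/

/-- A randomized streaming algorithm on updates from `U`, with `s` real memory words. Its coins
`Ω` have distribution `law`; they determine a read-only table of random values in `R` (a random
source that can be consulted again at every step) and the initial content of the memory. -/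
structure StreamAlgorithm (U Ω R : Type*) [MeasurableSpace Ω] (s : ℕ) where
  law : Measure Ω
  source : Ω → R
  init : Ω → (Fin s → ℝ)
  update : R → (Fin s → ℝ) → U × ℤ → (Fin s → ℝ)
  output : R → (Fin s → ℝ) → ℝ

namespace StreamAlgorithm

variable {U Ω R : Type*} [MeasurableSpace Ω] {s : ℕ}

/-- The content of the memory after the stream `S` has been processed. -/
def memory (A : StreamAlgorithm U Ω R s) (S : UpdateStream U) (ω : Ω) : Fin s → ℝ :=
  S.foldl (A.update (A.source ω)) (A.init ω)

/-- The value that is returned after the stream `S`. -/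
def result (A : StreamAlgorithm U Ω R s) (S : UpdateStream U) (ω : Ω) : ℝ :=
  A.output (A.source ω) (A.memory S ω)

/-- Internal state and output after the stream `S`. The internal state that an intruder sees is
everything the algorithm uses later on: the random table as well as the memory. -/
def run (A : StreamAlgorithm U Ω R s) (S : UpdateStream U) (ω : Ω) : (R × (Fin s → ℝ)) × ℝ :=
  ((A.source ω, A.memory S ω), A.result S ω)

/-- `ε`-pan-privacy against a single intrusion, for the pairs of streams related by `N`. -/
def PanPrivate [MeasurableSpace R] (A : StreamAlgorithm U Ω R s) (ε : ℝ)
    (N : UpdateStream U → UpdateStream U → Prop) : Prop :=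
  ∀ S S' : UpdateStream U, N S S' → ∀ E : Set ((R × (Fin s → ℝ)) × ℝ), MeasurableSet E →
    A.law {ω | A.run S ω ∈ E} ≤ ENNReal.ofReal (Real.exp ε) * A.law {ω | A.run S' ω ∈ E}

end StreamAlgorithm

/-! ### Laplace and stable distributions, medians -/

/-- The Laplace distribution with mean `0` and scale parameter `b`. -/
noncomputable def laplaceMeasure (b : ℝ) : Measure ℝ :=
  volume.withDensity fun x => ENNReal.ofReal (1 / (2 * b) * Real.exp (-|x| / b))

/-- If `Y` has distribution `Lap(1)` then `b * Y` has distribution `Lap(b)`. -/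
theorem laplaceMeasure_eq_map {b : ℝ} (hb : 0 < b) :
    laplaceMeasure b = (laplaceMeasure 1).map (fun y => b * y) := by
  have hm : MeasurableEmbedding (fun y : ℝ => b * y) :=
    (Homeomorph.mulLeft₀ b hb.ne').measurableEmbedding
  ext s hs
  rw [hm.map_apply, laplaceMeasure, laplaceMeasure, withDensity_apply _ hs,
    withDensity_apply _ (hm.measurable hs)]
  have hv : (volume : Measure ℝ) =
      ENNReal.ofReal |b| • Measure.map (fun y : ℝ => b * y) volume :=
    (Real.smul_map_volume_mul_left hb.ne').symm
  rw [hv, Measure.restrict_smul, lintegral_smul_measure, hm.restrict_map, hm.lintegral_map,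
    ← hv, smul_eq_mul, ← lintegral_const_mul']
  · refine lintegral_congr fun x => ?_
    rw [← ENNReal.ofReal_mul (abs_nonneg b), abs_mul, abs_of_pos hb]
    congr 1
    rw [show -(b * |x|) / b = -|x| / 1 by field_simp]
    field_simp
  · exact ENNReal.ofReal_ne_top

/-- `ν` is `p`-stable: for all real `b₁, …, bₙ` and independent `Y₁, …, Yₙ` with law `ν`, the
variable `∑ bᵢ Yᵢ` is distributed as `(∑ |bᵢ|^p)^(1/p) * Y` with `Y` of law `ν`. -/
def IsPStable (p : ℝ) (ν : Measure ℝ) : Prop :=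
  ∀ (n : ℕ) (b : Fin n → ℝ),
    (Measure.pi fun _ : Fin n => ν).map (fun y => ∑ i, b i * y i) =
      ν.map (fun y => (∑ i, |b i| ^ p) ^ (1 / p) * y)

/-- The median of `|X₀| ^ p`, where `X₀` has law `ν`. -/
noncomputable def absPowMedian (p : ℝ) (ν : Measure ℝ) : ℝ :=
  sInf {t : ℝ | 1 / 2 ≤ ν.real {x | |x| ^ p ≤ t}}

/-- The scale factor `B(p) = 1 / median |X₀| ^ p`. -/
noncomputable def scaleFactor (p : ℝ) (ν : Measure ℝ) : ℝ := 1 / absPowMedian p ν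

/-- The median of `r` real numbers: the `⌈r / 2⌉`-th smallest one. -/
noncomputable def sampleMedian {r : ℕ} (x : Fin r → ℝ) : ℝ :=
  if h : 0 < r then x (Tuple.sort x ⟨(r - 1) / 2, by omega⟩) else 0

/-! ### The algorithm -/

section Algorithm

variable {U : Type*} [Fintype U]

/-- `‖X_j‖_∞`, the largest absolute value in column `j`. -/
noncomputable def colNorm {r : ℕ} (X : U → Fin r → ℝ) (j : Fin r) : ℝ := ⨆ i, |X i j|

/-- `max_j ‖X_j‖_∞`. -/
noncomputable def maxColNorm {r : ℕ} (X : U → Fin r → ℝ) : ℝ := ⨆ j, colNorm X j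

/-- The coins: a matrix `X` and a vector `Y`. -/
abbrev SketchCoins (U : Type*) (r : ℕ) := (U → Fin r → ℝ) × (Fin r → ℝ)

/-- The entries of `X` have law `ν`, those of `Y` have law `Lap(1)`, and all are independent. -/
noncomputable def sketchLaw (U : Type*) [Fintype U] (r : ℕ) (ν : Measure ℝ) :
    Measure (SketchCoins U r) :=
  (Measure.pi fun _ : U => Measure.pi fun _ : Fin r => ν).prod
    (Measure.pi fun _ : Fin r => laplaceMeasure 1)

/-- The noisy sketch algorithm. It keeps `r` real counters. Given `X`, counter `j` starts with
noise of distribution `Lap(2 W ‖X_j‖_∞ / α)`, written as this scale times a `Lap(1)` variable.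
The update `(i, d)` adds `d * X i j` to counter `j`. The output is
`median_j |counter j| ^ p * B(p)`. -/
noncomputable def noisySketch (U : Type*) [Fintype U] (r : ℕ) (α p W : ℝ) (ν : Measure ℝ) :
    StreamAlgorithm U (SketchCoins U r) (U → Fin r → ℝ) r where
  law := sketchLaw U r ν
  source ω := ω.1
  init ω := fun j => 2 * W * colNorm ω.1 j / α * ω.2 j
  update X c u := fun j => c j + u.2 * X u.1 j
  output _ c := sampleMedian (fun j => |c j| ^ p) * scaleFactor p ν

/-- `ξ = ((2 W max_j ‖X_j‖_∞ / α) log (1/δ)) ^ p`. -/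
noncomputable def noiseBound {r : ℕ} (α δ p W : ℝ) (X : U → Fin r → ℝ) : ℝ :=
  (2 * W * maxColNorm X / α * Real.log (1 / δ)) ^ p

end Algorithm

/-! By stability the noiseless counters are independent copies of $F^{1/p}X_0$ with
$F=\sum_i|a_i|^p$. Nonzero $|a_i|$ lie in $[1,Z)$ and $p<\varepsilon/Z$ forces $Z^p\le
1+\frac34\varepsilon$, so $D\le F\le(1+\frac34\varepsilon)D$. It remains to recover $F$ from the
sample median of copies of $F|X_0|^p$.

The crux is `IsPStable.absPowMedian_bounds`: beyond $(1\pm\varepsilon/8)$ times the median,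
$|X_0|^p$ has mass at most $1/2-\kappa\varepsilon/18$, with $\kappa$ independent of $p$. Then
Hoeffding's inequality (`measureReal_pi_half_le_card_le`) makes
$r\gtrsim\varepsilon^{-2}\log(1/\delta)$ sketches enough, uniformly in $p$. To find $\kappa$, solve
the functional equation of the characteristic function, which gives $e^{-c|t|^p}$. Fourier inversion
and one integration by parts write $x$ times the density as $p\,c/(\pi x^p)$ times a sine integral
against a decreasing weight. That integral is bounded below uniformly in $p$ while
$c/x^p\in[1/20,20]$; hence $\log|X_0|^p$ has density at least $\kappa$ in the bulk. Crude tail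
estimates place the median in $[c/8,16c]$, well inside this window.

Since $p<1$, $|x+y|^p\le|x|^p+|y|^p$, so noise moves the median of the $p$-th powers by at most
$\xi$, unless one of the $r$ Laplace variables exceeds $\log(1/\delta)$ in absolute value.

Privacy is the Laplace mechanism conditionally on $X$: replacing updates of total $s$ moves counter
$j$ by $s(X_{i,j}-X_{i',j})$, at most $\alpha$ noise scales. Each counter costs a factor $e^\alpha$,
and the output is a function of table and memory. -/

/-! ### Characteristic functions of stable laws -/

/-- An additive function on the nonnegative reals that is continuous there is linear. -/
theorem eq_mul_of_continuousOn_of_add {L : ℝ → ℝ} (hc : ContinuousOn L (Set.Ici 0))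
    (hadd : ∀ x y, 0 ≤ x → 0 ≤ y → L (x + y) = L x + L y) {x : ℝ} (hx : 0 ≤ x) :
    L x = L 1 * x := by
  have h0 : L 0 = 0 := by simpa using hadd 0 0 le_rfl le_rfl
  -- The odd extension of $L$ to the line, written as $L(x^+)-L(x^-)$, so that linearity of
  -- continuous additive maps applies.
  let G : ℝ →+ ℝ :=
    { toFun := fun x => L (max x 0) - L (max (-x) 0)
      map_zero' := by simp
      map_add' := fun x y => by
        have h1 : max (x + y) 0 + (max (-x) 0 + max (-y) 0)
            = max (-(x + y)) 0 + (max x 0 + max y 0) := by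
          have key : ∀ z : ℝ, max z 0 = z + max (-z) 0 := fun z => by
            rcases le_total z 0 with hz | hz
            · rw [max_eq_right hz, max_eq_left (by linarith)]; ring
            · rw [max_eq_left hz, max_eq_right (by linarith)]; ring
          rw [key (x + y), key x, key y]; ring
        have h2 := congrArg L h1
        rw [hadd _ _ (by positivity) (by positivity), hadd _ _ (by positivity) (by positivity),
          hadd _ _ (by positivity) (by positivity), hadd _ _ (by positivity) (by positivity)] at h2
        linarith }
  have hG : Continuous G := by
    refine Continuous.sub ?_ ?_
    · exact hc.comp_continuous (by fun_prop) (fun x => by simp)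
    · exact hc.comp_continuous (by fun_prop) (fun x => by simp)
  have h := map_real_smul G hG x 1
  have e1 : G x = L x := by
    change L (max x 0) - L (max (-x) 0) = L x
    rw [max_eq_left hx, max_eq_right (by linarith), h0, sub_zero]
  have e2 : G 1 = L 1 := by
    change L (max 1 0) - L (max (-1) 0) = L 1
    rw [max_eq_left zero_le_one, max_eq_right (by norm_num), h0, sub_zero]
  rw [smul_eq_mul, mul_one, smul_eq_mul, e1, e2] at h
  rw [h, mul_comm]

/-- A continuous solution of `ψ (x + y) = ψ x * ψ y` on the nonnegative reals with `ψ 0 = 1` is an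
exponential. -/
theorem eq_exp_of_continuousOn_of_mul {ψ : ℝ → ℝ} (hc : ContinuousOn ψ (Set.Ici 0))
    (h0 : ψ 0 = 1) (hmul : ∀ x y, 0 ≤ x → 0 ≤ y → ψ (x + y) = ψ x * ψ y) :
    ∃ a : ℝ, ∀ x, 0 ≤ x → ψ x = Real.exp (a * x) := by
  have hpow : ∀ (n : ℕ) (x : ℝ), 0 ≤ x → ψ (n * x) = ψ x ^ n := fun n x hx => by
    induction n with
    | zero => simp [h0]
    | succ k ih =>
      rw [Nat.cast_succ, add_mul, one_mul, hmul _ _ (by positivity) hx, ih, pow_succ]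
  have hpos : ∀ x, 0 ≤ x → 0 < ψ x := fun x hx => by
    have hnn : 0 ≤ ψ x := by
      have := hmul (x / 2) (x / 2) (by positivity) (by positivity)
      rw [add_halves] at this
      rw [this]; exact mul_self_nonneg _
    -- A zero at $x$ would give zeros at all $x/(n+1)$, contradicting continuity at $0$, where the
    -- value is $1$.
    refine lt_of_le_of_ne hnn fun h => ?_
    have ht : Filter.Tendsto (fun n : ℕ => x / ((n : ℝ) + 1)) Filter.atTop
        (nhdsWithin 0 (Set.Ici 0)) := by
      refine tendsto_nhdsWithin_iff.2 ⟨?_, Filter.Eventually.of_forall fun n => ?_⟩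
      · have := (tendsto_one_div_add_atTop_nhds_zero_nat (𝕜 := ℝ)).const_mul x
        simpa [div_eq_mul_inv] using this
      · exact Set.mem_Ici.2 (by positivity)
    have h1 := (hc 0 (by simp)).tendsto.comp ht
    rw [h0] at h1
    obtain ⟨n, hn⟩ := (h1.eventually (lt_mem_nhds (zero_lt_one))).exists
    have h2 := hpow (n + 1) (x / ((n : ℝ) + 1)) (by positivity)
    rw [Nat.cast_succ, mul_div_cancel₀ _ (by positivity), ← h] at h2
    exact absurd h2 (pow_pos hn _).ne
  refine ⟨Real.log (ψ 1), fun x hx => ?_⟩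
  have := eq_mul_of_continuousOn_of_add (L := fun x => Real.log (ψ x))
    (hc.log fun x hx => (hpos x hx).ne') (fun x y hx hy => by
      rw [hmul x y hx hy, Real.log_mul (hpos x hx).ne' (hpos y hy).ne']) hx
  rw [← this, Real.exp_log (hpos x hx)]

theorem IsPStable.prod_charFun {p : ℝ} {ν : Measure ℝ} [IsProbabilityMeasure ν]
    (h : IsPStable p ν) {n : ℕ} (b : Fin n → ℝ) (t : ℝ) :
    ∏ i, charFun ν (b i * t) = charFun ν ((∑ i, |b i| ^ p) ^ (1 / p) * t) := by
  rw [← charFun_map_mul, ← h n b]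
  have h2 : (Measure.pi fun _ : Fin n => ν).map (fun y => ∑ i, b i * y i)
      = (Measure.pi fun i : Fin n => ν.map (fun y => b i * y)).map (fun y => ∑ i, y i) := by
    have : ∀ i : Fin n, IsProbabilityMeasure (ν.map (fun y => b i * y)) := fun i =>
      Measure.isProbabilityMeasure_map (by fun_prop)
    rw [← Measure.pi_map_pi (fun i => by fun_prop), Measure.map_map (by fun_prop) (by fun_prop)]
    rfl
  have : ∀ i : Fin n, IsProbabilityMeasure (ν.map (fun y => b i * y)) := fun i =>
    Measure.isProbabilityMeasure_map (by fun_prop)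
  rw [h2, ProbabilityTheory.charFun_map_sum_pi_eq_prod, Finset.prod_apply]
  simp [charFun_map_mul]

/-- The characteristic function of a nontrivial `p`-stable law is `exp (-c |t| ^ p)`. -/
theorem IsPStable.exists_charFun_eq {p : ℝ} {ν : Measure ℝ} [IsProbabilityMeasure ν] (hp : 0 < p)
    (h : IsPStable p ν) (hν : ν ≠ Measure.dirac 0) :
    ∃ c : ℝ, 0 < c ∧ ∀ t, charFun ν t = (Real.exp (-(c * |t| ^ p)) : ℝ) := by
  have heven : ∀ t, charFun ν (-t) = charFun ν t := fun t => by
    have := h.prod_charFun (n := 1) (fun _ => -1) t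
    simpa using this
  have hreal : ∀ t, charFun ν t = ((charFun ν t).re : ℂ) := fun t => by
    exact (Complex.conj_eq_iff_re.1 (by rw [← charFun_neg, heven])).symm
  have hadd : ∀ x y, 0 ≤ x → 0 ≤ y → charFun ν ((x + y) ^ (1 / p))
      = charFun ν (x ^ (1 / p)) * charFun ν (y ^ (1 / p)) := fun x y hx hy => by
    have := h.prod_charFun (n := 2) ![x ^ (1 / p), y ^ (1 / p)] 1
    have e : ∀ z : ℝ, 0 ≤ z → |z ^ (1 / p)| ^ p = z := fun z hz => by
      rw [abs_of_nonneg (by positivity), one_div, Real.rpow_inv_rpow hz hp.ne']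
    simp only [Fin.sum_univ_two, Fin.prod_univ_two, mul_one, Matrix.cons_val_zero,
      Matrix.cons_val_one, e x hx, e y hy] at this
    exact this.symm
  -- The substitution $t=u^{1/p}$ turns stability with two summands into multiplicativity in $u$.
  obtain ⟨a, ha⟩ := eq_exp_of_continuousOn_of_mul (ψ := fun u => (charFun ν (u ^ (1 / p))).re)
    (by
      refine Continuous.continuousOn ?_
      exact Complex.continuous_re.comp ((continuous_charFun (μ := ν)).comp
        (Real.continuous_rpow_const (by positivity))))
    (by simp [Real.zero_rpow (inv_pos.2 hp).ne'])
    (fun x y hx hy => by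
      rw [hadd x y hx hy, hreal (x ^ (1 / p)), hreal (y ^ (1 / p)), ← Complex.ofReal_mul]
      rfl)
  have habs : ∀ t, charFun ν t = (Real.exp (a * |t| ^ p) : ℝ) := fun t => by
    have h1 : charFun ν t = charFun ν |t| := by
      rcases abs_choice t with ht | ht
      · rw [ht]
      · rw [ht, heven]
    rw [h1, hreal, ← ha _ (by positivity), one_div, Real.rpow_rpow_inv (abs_nonneg t) hp.ne']
  have ha0 : a ≤ 0 := by
    have h1 := norm_charFun_le_one (μ := ν) 1
    rw [habs, Complex.norm_real, Real.norm_eq_abs, Real.abs_exp] at h1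
    simpa using h1
  refine ⟨-a, ?_, fun t => by rw [habs t]; ring_nf⟩
  rcases ha0.lt_or_eq with h1 | h1
  · linarith
  · refine absurd (Measure.ext_of_charFun ?_) hν
    ext t
    rw [habs t, h1]
    simp

/-! ### A lower bound for oscillatory integrals -/

open Set Filter Topology in
/-- If `q` is nonnegative and antitone then `∫₀^∞ sin s * q s` is at least the contribution of a
part of the first half period, paired with its translate. -/
theorem le_integral_Ioi_sin_mul {q : ℝ → ℝ} (hq : AntitoneOn q (Ioi 0))
    (hi : IntegrableOn (fun s => Real.sin s * q s) (Ioi 0)) {a b κ : ℝ} (ha : 0 < a) (hab : a ≤ b)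
    (hb : b ≤ Real.pi) (hκ : ∀ s ∈ Icc a b, κ ≤ Real.sin s * (q s - q (s + Real.pi))) :
    κ * (b - a) ≤ ∫ s in Ioi 0, Real.sin s * q s := by
  have hπ := Real.pi_pos
  have hii : ∀ x y : ℝ, 0 ≤ x → 0 ≤ y →
      IntervalIntegrable (fun s => Real.sin s * q s) volume x y := fun x y hx hy => by
    refine (intervalIntegrable_iff.2 (hi.mono_set ?_))
    intro z hz
    exact lt_of_le_of_lt (le_min hx hy) hz.1
  -- one period
  have hii' : ∀ x y : ℝ, 0 ≤ x → 0 ≤ y →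
      IntervalIntegrable (fun s => Real.sin s * q (s + Real.pi)) volume x y := fun x y hx hy => by
    have := (hii (x + Real.pi) (y + Real.pi) (by positivity) (by positivity)).comp_add_right
      Real.pi
    simp only [add_sub_cancel_right, Real.sin_add_pi] at this
    convert this.neg using 1
    ext s
    simp
  -- As $\sin(s+\pi)=-\sin s$, the two half periods combine into one integral against the decrease
  -- of $q$ over $\pi$.
  have hper : ∀ x : ℝ, 0 ≤ x → ∫ s in x..(x + 2 * Real.pi), Real.sin s * q s
      = ∫ s in x..(x + Real.pi), Real.sin s * (q s - q (s + Real.pi)) := fun x hx => by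
    rw [← intervalIntegral.integral_add_adjacent_intervals
      (hii x (x + Real.pi) hx (by positivity)) (hii _ _ (by positivity) (by positivity))]
    have : ∫ s in (x + Real.pi)..(x + 2 * Real.pi), Real.sin s * q s
        = ∫ s in x..(x + Real.pi), Real.sin (s + Real.pi) * q (s + Real.pi) := by
      rw [intervalIntegral.integral_comp_add_right (fun s => Real.sin s * q s)]
      ring_nf
    rw [this, ← intervalIntegral.integral_add (hii _ _ hx (by positivity))]
    · refine intervalIntegral.integral_congr fun s _ => ?_
      simp only [Real.sin_add_pi]
      ring
    · convert (hii' x (x + Real.pi) hx (by positivity)).neg using 1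
      ext s
      simp [Real.sin_add_pi]
  have hdiff : ∀ s, 0 < s → 0 ≤ q s - q (s + Real.pi) := fun s hs =>
    sub_nonneg.2 (hq hs (show (0 : ℝ) < s + Real.pi by positivity) (by linarith))
  have hnn : ∀ n : ℕ, 0 ≤ ∫ s in (n * (2 * Real.pi))..((n + 1 : ℕ) * (2 * Real.pi)),
      Real.sin s * q s := fun n => by
    rw [Nat.cast_succ, add_mul, one_mul, hper _ (by positivity)]
    refine intervalIntegral.integral_nonneg_of_ae_restrict (by linarith) ?_
    rw [EventuallyLE, ae_restrict_iff' measurableSet_Icc]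
    -- Monotonicity of $q$ is known only on the open half-line, so the endpoint $0$ is discarded as
    -- a null set.
    filter_upwards [(measure_eq_zero_iff_ae_notMem.1 (measure_singleton (μ := volume) (0 : ℝ)))]
      with s hs0 hs
    have h0 : (0 : ℝ) ≤ n * (2 * Real.pi) := by positivity
    refine mul_nonneg ?_ (hdiff s (lt_of_le_of_ne (h0.trans hs.1) fun h => hs0 h.symm))
    rw [← Real.sin_sub_nat_mul_two_pi s n]
    exact Real.sin_nonneg_of_nonneg_of_le_pi (by linarith [hs.1]) (by linarith [hs.2])
  have hfirst : κ * (b - a) ≤ ∫ s in (0 : ℝ)..(2 * Real.pi), Real.sin s * q s := by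
    have h0 := hper 0 le_rfl
    rw [zero_add, zero_add] at h0
    rw [h0]
    have hIi : ∀ x y : ℝ, 0 ≤ x → 0 ≤ y → IntervalIntegrable
        (fun s => Real.sin s * (q s - q (s + Real.pi))) volume x y := fun x y hx hy => by
      simpa [mul_sub] using (hii x y hx hy).sub (hii' x y hx hy)
    calc κ * (b - a) = ∫ _ in a..b, κ := by simp [mul_comm]
      _ ≤ ∫ s in a..b, Real.sin s * (q s - q (s + Real.pi)) :=
          intervalIntegral.integral_mono_on hab (by simp) (hIi _ _ ha.le (ha.le.trans hab)) hκ
      _ ≤ _ := by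
          refine intervalIntegral.integral_mono_interval ha.le hab hb ?_
            (hIi _ _ le_rfl hπ.le)
          rw [EventuallyLE, ae_restrict_iff' measurableSet_Ioc]
          refine Eventually.of_forall fun s hs => mul_nonneg ?_ (hdiff s hs.1)
          exact Real.sin_nonneg_of_nonneg_of_le_pi hs.1.le hs.2
  have hall : ∀ n : ℕ, κ * (b - a)
      ≤ ∫ s in (0 : ℝ)..((n + 1 : ℕ) * (2 * Real.pi)), Real.sin s * q s := fun n => by
    induction n with
    | zero => simpa using hfirst
    | succ k ih =>
      rw [← intervalIntegral.integral_add_adjacent_intervals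
        (hii 0 ((k + 1 : ℕ) * (2 * Real.pi)) le_rfl (by positivity))
        (hii _ _ (by positivity) (by positivity))]
      exact ih.trans (le_add_of_nonneg_right (hnn (k + 1)))
  have hlim := intervalIntegral_tendsto_integral_Ioi (0 : ℝ) hi
    (tendsto_natCast_atTop_atTop (R := ℝ) |>.comp (tendsto_add_atTop_nat 1)
      |>.atTop_mul_const (show 0 < 2 * Real.pi by positivity))
  exact ge_of_tendsto' hlim hall

/-- Uniform relative decrease of the weight $s^{p-1}e^{-ws^p}$ when $s\ge1$ is doubled. For small
$p$ the power $2^{p-1}$ provides it; near $p=1$ the exponential does, which is why $w$ must stay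
away from $0$. -/
theorem one_div_le_sub_two_rpow_mul_exp {p w : ℝ} (hp : 0 < p) (hp1 : p < 1) (hw : 1 / 20 ≤ w) :
    1 / 420 ≤ 1 - (2 : ℝ) ^ (p - 1) * Real.exp (-(w * (2 ^ p - 1))) := by
  have hy1 : (1 : ℝ) ≤ 2 ^ p := Real.one_le_rpow one_le_two hp.le
  have hy2 : (2 : ℝ) ^ p ≤ 2 := by
    simpa using Real.rpow_le_rpow_of_exponent_le one_le_two hp1.le
  rw [Real.rpow_sub_one two_ne_zero]
  set y : ℝ := 2 ^ p
  have hu : 0 ≤ w * (y - 1) := mul_nonneg (by linarith) (by linarith)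
  have h1 : Real.exp (-(w * (y - 1))) ≤ 1 / (1 + w * (y - 1)) := by
    rw [Real.exp_neg, ← one_div]
    exact one_div_le_one_div_of_le (by linarith) (by linarith [Real.add_one_le_exp (w * (y - 1))])
  have h2 : y / 2 * Real.exp (-(w * (y - 1))) ≤ y / 2 * (1 / (1 + w * (y - 1))) :=
    mul_le_mul_of_nonneg_left h1 (by linarith)
  have h3 : y / 2 * (1 / (1 + w * (y - 1))) ≤ 1 - 1 / 420 := by
    rw [div_mul_div_comm, mul_one, div_le_iff₀ (by linarith)]
    nlinarith [mul_nonneg (sub_nonneg.2 hw) (sub_nonneg.2 hy1)]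
  linarith

open Set in
theorem antitoneOn_rpow_mul_exp {p w : ℝ} (hp : 0 < p) (hp1 : p < 1) (hw : 0 < w) :
    AntitoneOn (fun s : ℝ => s ^ (p - 1) * Real.exp (-(w * s ^ p))) (Ioi 0) := by
  intro s hs t ht hst
  have hs : 0 < s := hs
  have ht : 0 < t := ht
  refine mul_le_mul (Real.rpow_le_rpow_of_nonpos hs hst (by linarith)) ?_ (Real.exp_pos _).le
    (by positivity)
  gcongr

open Set in
/-- A lower bound, uniform in `p`, for an oscillatory integral. -/
theorem le_integral_sin_mul_rpow_mul_exp {p w : ℝ} (hp : 0 < p) (hp1 : p < 1) (hw : 1 / 20 ≤ w)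
    (hw' : w ≤ 20) : Real.exp (-40) / 1680 ≤
      ∫ s in Ioi (0 : ℝ), Real.sin s * (s ^ (p - 1) * Real.exp (-(w * s ^ p))) := by
  have hw0 : 0 < w := by linarith
  have hanti := antitoneOn_rpow_mul_exp hp hp1 hw0
  have hint : IntegrableOn (fun s : ℝ => s ^ (p - 1) * Real.exp (-(w * s ^ p))) (Ioi 0) := by
    simpa using integrableOn_rpow_mul_exp_neg_mul_rpow (s := p - 1) (by linarith) hp hw0
  have hint' : IntegrableOn
      (fun s : ℝ => Real.sin s * (s ^ (p - 1) * Real.exp (-(w * s ^ p)))) (Ioi 0) :=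
    hint.bdd_mul (c := 1) (by fun_prop) (Filter.Eventually.of_forall fun s => by
      simpa using Real.abs_sin_le_one s)
  have hpi := Real.pi_gt_three
  have h := le_integral_Ioi_sin_mul hanti hint' (a := 1) (b := 2) (κ := Real.exp (-40) / 1680)
    one_pos one_le_two (by linarith) (fun s hs => ?_)
  · simpa using! (by linarith : Real.exp (-40) / 1680 ≤ _)
  have hs1 : 1 ≤ s := hs.1
  have hs2 : s ≤ 2 := hs.2
  have hsin : 1 / 2 ≤ Real.sin s := by
    have key : ∀ y : ℝ, 1 ≤ y → y ≤ Real.pi / 2 → 1 / 2 ≤ Real.sin y := fun y hy hy' => by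
      refine le_trans ?_ (Real.mul_le_sin (by linarith) hy')
      rw [div_mul_eq_mul_div, div_le_div_iff₀ two_pos Real.pi_pos]
      linarith [Real.pi_le_four]
    rcases le_total s (Real.pi / 2) with h | h
    · exact key s hs1 h
    · rw [← Real.sin_pi_sub]
      exact key _ (by linarith) (by linarith)
  have hsp : s ^ p ≤ 2 := by
    calc s ^ p ≤ s ^ (1 : ℝ) := Real.rpow_le_rpow_of_exponent_le hs1 hp1.le
      _ ≤ 2 := by simpa using hs2
  have hfac : 1 / 2 ≤ s ^ (p - 1) := by
    calc (1 : ℝ) / 2 = 2 ^ (-1 : ℝ) := by rw [Real.rpow_neg_one]; norm_num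
      _ ≤ 2 ^ (p - 1) := Real.rpow_le_rpow_of_exponent_le one_le_two (by linarith)
      _ ≤ s ^ (p - 1) := Real.rpow_le_rpow_of_nonpos (by linarith) hs2 (by linarith)
  have hexp : Real.exp (-40) ≤ Real.exp (-(w * s ^ p)) := by
    gcongr
    -- $w\le20$ and $s^p\le2$ give the exponent $40$.
    nlinarith [Real.rpow_nonneg (by linarith : (0 : ℝ) ≤ s) p]
  have hle : (s + Real.pi) ^ (p - 1) * Real.exp (-(w * (s + Real.pi) ^ p))
      ≤ s ^ (p - 1) * Real.exp (-(w * s ^ p)) * (2 ^ (p - 1) * Real.exp (-(w * (2 ^ p - 1)))) := by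
    -- Since $s\le2<\pi$, the shift $s+\pi$ lies beyond $2s$, and doubling can be computed exactly.
    refine (hanti (show (0 : ℝ) < 2 * s by linarith) (show (0 : ℝ) < s + Real.pi by linarith)
      (by linarith)).trans ?_
    simp only
    rw [Real.mul_rpow (by norm_num) (by linarith), Real.mul_rpow (by norm_num) (by linarith),
      mul_mul_mul_comm, ← Real.exp_add, mul_comm (2 ^ (p - 1) : ℝ)]
    refine mul_le_mul_of_nonneg_left ?_ (by positivity)
    gcongr
    have h1 : 1 ≤ s ^ p := Real.one_le_rpow hs1 hp.le
    have hy1 : (1 : ℝ) ≤ 2 ^ p := Real.one_le_rpow one_le_two hp.le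
    nlinarith [mul_nonneg hw0.le (mul_nonneg (sub_nonneg.2 h1) (sub_nonneg.2 hy1))]
  have h420 := one_div_le_sub_two_rpow_mul_exp hp hp1 hw
  calc Real.exp (-40) / 1680 = 1 / 2 * (1 / 2 * Real.exp (-40) * (1 / 420)) := by ring
    _ ≤ Real.sin s * (s ^ (p - 1) * Real.exp (-(w * s ^ p)) *
        (1 - 2 ^ (p - 1) * Real.exp (-(w * (2 ^ p - 1))))) := by gcongr
    _ ≤ _ := by
      refine mul_le_mul_of_nonneg_left ?_ (by linarith)
      linarith

/-! ### Densities of stable laws -/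

/-- Fourier inversion for measures, tested on smooth functions with compact support. -/
theorem integral_eq_integral_mul_fourier_charFun {ν : Measure ℝ} [IsProbabilityMeasure ν]
    {Φ : ℝ → ℝ} (hΦ : ∀ t, charFun ν t = Φ t) (hint : Integrable fun ξ : ℝ => Φ (-(2 * Real.pi * ξ)))
    {g : ℝ → ℝ} (hg : ContDiff ℝ (⊤ : ℕ∞) g) (hgc : HasCompactSupport g) :
    let f : ℝ → ℝ := fun x => ∫ ξ : ℝ, Φ (-(2 * Real.pi * ξ)) * Real.cos (2 * Real.pi * ξ * x)
    Continuous f ∧ ∫ x, g x ∂ν = ∫ x, g x * f x := by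
  intro f
  have hcd : ContDiff ℝ (⊤ : ℕ∞) (fun x => (g x : ℂ)) := Complex.ofRealCLM.contDiff.comp hg
  have hcs : HasCompactSupport (fun x => (g x : ℂ)) := hgc.comp_left Complex.ofReal_zero
  let G : SchwartzMap ℝ ℂ := hcs.toSchwartzMap hcd
  have hG : ∀ x, G x = g x := fun x => rfl
  let h : SchwartzMap ℝ ℂ := FourierTransform.fourierInv G
  have hGh : G = FourierTransform.fourier h := (FourierTransform.fourier_fourierInv_eq G).symm
  let Ψ : ℝ → ℂ := fun ξ => (Φ (-(2 * Real.pi * ξ)) : ℂ)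
  have hΨ : Integrable Ψ := hint.ofReal
  have hL : Continuous fun p : ℝ × ℝ => (-innerₗ ℝ) p.1 p.2 :=
    (continuous_inner (𝕜 := ℝ) (E := ℝ)).neg
  let F : ℝ → ℂ := VectorFourier.fourierIntegral Real.fourierChar volume (-innerₗ ℝ) Ψ
  have hFc : Continuous F := VectorFourier.fourierIntegral_continuous Real.continuous_fourierChar
    hL hΨ
  have hF : ∀ x, (F x).re = f x := fun x => by
    have h1 : F x = ∫ ξ : ℝ, Complex.exp ((2 * Real.pi * (ξ * x) : ℝ) * Complex.I) * Ψ ξ := by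
      change ∫ v, _ ∂_ = _
      refine integral_congr_ae (Filter.Eventually.of_forall fun ξ => ?_)
      simp only [Circle.smul_def, Real.fourierChar_apply, LinearMap.neg_apply, neg_neg, smul_eq_mul]
      simp [mul_comm]
    have h2 : Integrable (fun ξ : ℝ =>
        Complex.exp ((2 * Real.pi * (ξ * x) : ℝ) * Complex.I) * Ψ ξ) :=
      hΨ.bdd_mul (c := 1) (by fun_prop) (Filter.Eventually.of_forall fun ξ => by
        rw [Complex.norm_exp_ofReal_mul_I])
    rw [h1, ← RCLike.re_eq_complex_re, ← integral_re h2]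
    refine integral_congr_ae (Filter.Eventually.of_forall fun ξ => ?_)
    simp only [RCLike.re_eq_complex_re, Ψ]
    rw [Complex.re_mul_ofReal, Complex.exp_ofReal_mul_I_re, mul_comm, mul_assoc (2 * Real.pi)]
  have hfc : Continuous f := by
    have : f = fun x => (F x).re := funext fun x => (hF x).symm
    rw [this]
    exact Complex.continuous_re.comp hFc
  refine ⟨hfc, ?_⟩
  -- With $h$ the inverse transform of the test function, Fubini is used twice: here against $\nu$,
  -- then in `e2` against Lebesgue measure. Both pairings equal $\int\Psi h$.
  have e1 : ∫ ξ, Ψ ξ • h ξ = ∫ x, G x ∂ν := by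
    have := VectorFourier.integral_fourierIntegral_smul_eq_flip (μ := ν) (ν := volume)
      (L := innerₗ ℝ) (f := fun _ => (1 : ℂ)) (g := h) Real.continuous_fourierChar continuous_inner
      (integrable_const _) h.integrable
    calc ∫ ξ, Ψ ξ • h ξ = _ := by
          refine Eq.trans (integral_congr_ae (Filter.Eventually.of_forall fun ξ => ?_)) this
          simp only [Ψ]
          rw [← hΦ, charFun_eq_fourierIntegral']
          congr 2
          simp
          field_simp
      _ = ∫ x, G x ∂ν := by
          refine integral_congr_ae (Filter.Eventually.of_forall fun x => ?_)
          simp only [one_smul]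
          rw [hGh]
          simp [SchwartzMap.fourier_coe, Real.fourier_eq, VectorFourier.fourierIntegral]
  have e2 : ∫ x, F x • G x = ∫ ξ, Ψ ξ • h ξ := by
    have := VectorFourier.integral_fourierIntegral_smul_eq_flip (μ := volume) (ν := volume)
      (L := -innerₗ ℝ) (f := Ψ) (g := G) Real.continuous_fourierChar
      hL hΨ G.integrable
    refine this.trans (integral_congr_ae (Filter.Eventually.of_forall fun ξ => ?_))
    simp only [h]
    congr 1
    simp [SchwartzMap.fourierInv_coe, Real.fourierInv_eq, VectorFourier.fourierIntegral, mul_comm]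
  have e3 : ((∫ x, g x ∂ν : ℝ) : ℂ) = ∫ x, F x • G x := by
    rw [e2, e1]
    exact integral_complex_ofReal.symm
  have e4 : Integrable fun x => F x • G x :=
    (hFc.smul G.continuous).integrable_of_hasCompactSupport hcs.smul_left
  rw [← Complex.ofReal_re (∫ x, g x ∂ν), e3, ← RCLike.re_eq_complex_re, ← integral_re e4]
  refine integral_congr_ae (Filter.Eventually.of_forall fun x => ?_)
  simp only [RCLike.re_eq_complex_re, hG, smul_eq_mul]
  rw [Complex.re_mul_ofReal, hF, mul_comm]

open Set Filter Topology in
/-- The density of a symmetric stable law as an absolutely convergent oscillatory integral. -/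
theorem integral_Ioi_cos_mul_exp {p c x : ℝ} (hp : 0 < p) (hc : 0 < c) (hx : 0 < x) :
    ∫ t in Ioi (0 : ℝ), Real.exp (-(c * t ^ p)) * Real.cos (t * x) =
      p / x * (c / x ^ p) *
        ∫ s in Ioi (0 : ℝ), Real.sin s * (s ^ (p - 1) * Real.exp (-(c / x ^ p * s ^ p))) := by
  have hintE : IntegrableOn (fun t : ℝ => Real.exp (-(c * t ^ p))) (Ioi 0) := by
    simpa using integrableOn_rpow_mul_exp_neg_mul_rpow (s := 0) (by norm_num) hp hc
  have hint : IntegrableOn (fun s : ℝ => s ^ (p - 1) * Real.exp (-(c * s ^ p))) (Ioi 0) := by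
    simpa using integrableOn_rpow_mul_exp_neg_mul_rpow (s := p - 1) (by linarith) hp hc
  have hv : ∀ t ∈ Ioi (0 : ℝ), HasDerivAt (fun t => Real.sin (t * x) / x) (Real.cos (t * x)) t :=
    fun t _ => by
      have := ((hasDerivAt_id t).mul_const x).sin.div_const x
      simpa [hx.ne'] using this
  have hu : ∀ t ∈ Ioi (0 : ℝ), HasDerivAt (fun t => Real.exp (-(c * t ^ p)))
      (-(c * p) * (t ^ (p - 1) * Real.exp (-(c * t ^ p)))) t := fun t ht => by
    have := ((Real.hasDerivAt_rpow_const (p := p) (Or.inl (ne_of_gt ht))).const_mul c).neg.exp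
    refine this.congr_deriv ?_
    simp only [Pi.neg_apply]
    ring
  have hzero : Tendsto ((fun t => Real.exp (-(c * t ^ p))) * fun t => Real.sin (t * x) / x)
      (𝓝[>] 0) (𝓝 0) := by
    have : Continuous ((fun t => Real.exp (-(c * t ^ p))) * fun t => Real.sin (t * x) / x) := by
      have := Real.continuous_rpow_const hp.le
      exact (by fun_prop : Continuous fun t : ℝ => Real.exp (-(c * t ^ p))).mul (by fun_prop)
    simpa using (this.tendsto 0).mono_left nhdsWithin_le_nhds
  have hinfty : Tendsto ((fun t => Real.exp (-(c * t ^ p))) * fun t => Real.sin (t * x) / x)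
      atTop (𝓝 0) := by
    have h1 : Tendsto (fun t : ℝ => Real.exp (-(c * t ^ p))) atTop (𝓝 0) :=
      Real.tendsto_exp_neg_atTop_nhds_zero.comp ((tendsto_rpow_atTop hp).const_mul_atTop hc)
    refine h1.zero_mul_isBoundedUnder_le (isBoundedUnder_of ⟨1 / x, fun t => ?_⟩)
    simp only [Function.comp_apply, Real.norm_eq_abs, abs_div, abs_of_pos hx]
    gcongr
    exact Real.abs_sin_le_one _
  -- Differentiating the exponential produces the factor $p$ and the decreasing weight
  -- $t^{p-1}e^{-ct^p}$; both boundary terms vanish.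
  have hib := integral_Ioi_mul_deriv_eq_deriv_mul hu hv
    (hintE.mul_bdd (c := 1) (by fun_prop) (Eventually.of_forall fun t => by
      simpa using Real.abs_cos_le_one (t * x)))
    ((hint.const_mul (-(c * p))).mul_bdd (c := 1 / x) (by fun_prop)
      (Eventually.of_forall fun t => by
        simp only [Real.norm_eq_abs, abs_div, abs_of_pos hx]
        gcongr
        exact Real.abs_sin_le_one _)) hzero hinfty
  rw [hib, sub_zero, zero_sub]
  have hsub := integral_comp_mul_right_Ioi
    (fun s => Real.sin s * (s ^ (p - 1) * Real.exp (-(c / x ^ p * s ^ p)))) 0 hx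
  rw [zero_mul, smul_eq_mul, eq_comm, inv_mul_eq_iff_eq_mul₀ hx.ne'] at hsub
  rw [hsub, ← integral_neg, ← integral_const_mul, ← integral_const_mul]
  refine setIntegral_congr_fun measurableSet_Ioi fun t ht => ?_
  have ht : 0 < t := ht
  have hxp : 0 < x ^ p := by positivity
  rw [Real.mul_rpow ht.le hx.le, Real.mul_rpow ht.le hx.le, Real.rpow_sub_one hx.ne' p,
    show c / x ^ p * (t ^ p * x ^ p) = c * t ^ p by field_simp]
  field_simp

open Set in
theorem integral_exp_mul_cos_eq {p c x : ℝ} :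
    ∫ ξ : ℝ, Real.exp (-(c * |-(2 * Real.pi * ξ)| ^ p)) * Real.cos (2 * Real.pi * ξ * x) =
      Real.pi⁻¹ * ∫ t in Ioi (0 : ℝ), Real.exp (-(c * t ^ p)) * Real.cos (t * x) := by
  have h1 := integral_comp_abs (f := fun ξ : ℝ =>
    Real.exp (-(c * (2 * Real.pi * ξ) ^ p)) * Real.cos (2 * Real.pi * ξ * x))
  have h2 := integral_comp_mul_left_Ioi
    (fun t : ℝ => Real.exp (-(c * t ^ p)) * Real.cos (t * x)) 0 Real.two_pi_pos
  rw [h2, mul_zero, smul_eq_mul, mul_inv, ← mul_assoc, ← mul_assoc, mul_inv_cancel₀ two_ne_zero,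
    one_mul] at h1
  rw [← h1]
  refine integral_congr_ae (Filter.Eventually.of_forall fun ξ => ?_)
  simp only
  rw [abs_neg, abs_mul, abs_of_pos Real.two_pi_pos]
  congr 1
  rcases abs_choice ξ with h | h
  · rw [h]
  · rw [h, mul_neg, neg_mul, Real.cos_neg]

/-- A lower bound for the density of `log |X| ^ p` in the bulk, for `X` with a `p`-stable law. -/
noncomputable def stableDensityBound : ℝ := Real.exp (-40) / (33600 * Real.pi)

theorem stableDensityBound_pos : 0 < stableDensityBound := by
  unfold stableDensityBound
  positivity

open Set in
theorem integrable_exp_neg_mul_abs_rpow_comp {p c : ℝ} (hp : 0 < p) (hc : 0 < c) :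
    Integrable fun ξ : ℝ => Real.exp (-(c * |-(2 * Real.pi * ξ)| ^ p)) := by
  have h2 : IntegrableOn (fun t : ℝ => Real.exp (-(c * |t| ^ p))) (Ioi 0) := by
    have h3 : IntegrableOn (fun t : ℝ => Real.exp (-(c * t ^ p))) (Ioi 0) := by
      simpa using integrableOn_rpow_mul_exp_neg_mul_rpow (s := 0) (by norm_num) hp hc
    exact h3.congr_fun (fun t ht => by simp only [abs_of_pos (show (0 : ℝ) < t from ht)])
      measurableSet_Ioi
  have h3 : IntegrableOn (fun t : ℝ => Real.exp (-(c * |t| ^ p))) (Iic 0) := by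
    rw [integrableOn_Iic_iff_integrableOn_Iio]
    have := (Measure.measurePreserving_neg (volume : Measure ℝ)).integrableOn_comp_preimage
      (Homeomorph.neg ℝ).measurableEmbedding |>.2 h2
    simpa [Function.comp_def] using this
  have h1 : Integrable fun t : ℝ => Real.exp (-(c * |t| ^ p)) := by
    rw [← integrableOn_univ, ← Iic_union_Ioi (a := (0 : ℝ))]
    exact h3.union h2
  have h4 := h1.comp_mul_left' (R := -(2 * Real.pi)) (by simp [Real.pi_ne_zero])
  simpa only [neg_mul] using h4

-- On the window the density is at least $\kappa p/x$, whose integral is the logarithm. The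
-- inversion formula tests only smooth functions, so bump functions supported in the interval are
-- used and their plateaus expanded to fill it.
open Set Filter Topology in
theorem le_measureReal_Ioo_of_charFun_eq {p c a b : ℝ} {ν : Measure ℝ} [IsProbabilityMeasure ν]
    (hp : 0 < p) (hp1 : p < 1) (hc : 0 < c)
    (hν : ∀ t, charFun ν t = (Real.exp (-(c * |t| ^ p)) : ℝ)) (ha : 0 < a) (hab : a < b)
    (hwb : 1 / 20 ≤ c / b ^ p) (hwa : c / a ^ p ≤ 20) :
    stableDensityBound * (p * Real.log (b / a)) ≤ ν.real (Ioo a b) := by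
  set κ := stableDensityBound
  have hint := integrable_exp_neg_mul_abs_rpow_comp hp hc
  have hdens : ∀ x ∈ Ioo a b, κ * p * (1 / x) ≤
      ∫ ξ : ℝ, Real.exp (-(c * |-(2 * Real.pi * ξ)| ^ p)) * Real.cos (2 * Real.pi * ξ * x) := by
    intro x hx
    have hx0 : 0 < x := ha.trans hx.1
    rw [integral_exp_mul_cos_eq, integral_Ioi_cos_mul_exp hp hc hx0]
    have hw1 : 1 / 20 ≤ c / x ^ p := hwb.trans (by gcongr; exact hx.2.le)
    have hw2 : c / x ^ p ≤ 20 := le_trans (by gcongr; exact hx.1.le) hwa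
    have hJ := le_integral_sin_mul_rpow_mul_exp hp hp1 hw1 hw2
    calc κ * p * (1 / x)
        -- This fixes `stableDensityBound`: $33600=20\cdot1680$, with $1/20$ the lower bound for
        -- $c/x^p$.
        = Real.pi⁻¹ * (p / x * (1 / 20) * (Real.exp (-40) / 1680)) := by
          simp only [κ, stableDensityBound]
          field_simp
          norm_num
      _ ≤ _ := by gcongr
  have key : ∀ r, 0 < r → r < (b - a) / 2 →
      κ * (p * Real.log (((a + b) / 2 + r) / ((a + b) / 2 - r))) ≤ ν.real (Ioo a b) := by
    intro r hr hr'
    let g : ContDiffBump ((a + b) / 2) := ⟨r, (b - a) / 2, hr, hr'⟩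
    obtain ⟨hfc, heq⟩ := integral_eq_integral_mul_fourier_charFun (Φ := fun t =>
      Real.exp (-(c * |t| ^ p))) hν hint (g := g) g.contDiff g.hasCompactSupport
    set f := fun x : ℝ => ∫ ξ : ℝ, Real.exp (-(c * |-(2 * Real.pi * ξ)| ^ p)) *
      Real.cos (2 * Real.pi * ξ * x)
    have hsupp : ∀ x, x ∉ Ioo a b → g x = 0 := fun x hx => by
      refine g.zero_of_le_dist ?_
      rw [Real.dist_eq]
      by_contra! h
      rw [abs_lt, show g.rOut = (b - a) / 2 from rfl] at h
      exact hx ⟨by linarith [h.1], by linarith [h.2]⟩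
    have hup : ∫ x, g x ∂ν ≤ ν.real (Ioo a b) := by
      rw [← integral_indicator_one measurableSet_Ioo]
      refine integral_mono (g.continuous.integrable_of_hasCompactSupport g.hasCompactSupport)
        ((integrable_const 1).indicator measurableSet_Ioo) fun x => ?_
      by_cases hx : x ∈ Ioo a b
      · simpa [hx] using g.le_one
      · simp [hx, hsupp x hx]
    have hgf : Integrable fun x => g x * f x :=
      (g.continuous.mul hfc).integrable_of_hasCompactSupport g.hasCompactSupport.mul_right
    have hnn : ∀ x, 0 ≤ g x * f x := fun x => by
      by_cases hx : x ∈ Ioo a b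
      · have : 0 < x := ha.trans hx.1
        exact mul_nonneg g.nonneg (le_trans (by have := stableDensityBound_pos; positivity)
          (hdens x hx))
      · simp [hsupp x hx]
    have hm : 0 < (a + b) / 2 - r := by linarith
    calc κ * (p * Real.log (((a + b) / 2 + r) / ((a + b) / 2 - r)))
        = ∫ x in ((a + b) / 2 - r)..((a + b) / 2 + r), κ * p * (1 / x) := by
          rw [intervalIntegral.integral_const_mul, integral_one_div_of_pos hm (by linarith)]
          ring
      _ ≤ ∫ x in ((a + b) / 2 - r)..((a + b) / 2 + r), g x * f x := by
          refine intervalIntegral.integral_mono_on (by linarith) ?_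
            hgf.intervalIntegrable fun x hx => ?_
          · refine ContinuousOn.intervalIntegrable ?_
            rw [uIcc_of_le (by linarith)]
            refine continuousOn_const.mul (continuousOn_const.div continuousOn_id fun x hx => ?_)
            exact (hm.trans_le hx.1).ne'
          · have hgx : g x = 1 := by
              refine g.one_of_mem_closedBall ?_
              rw [Real.closedBall_eq_Icc]
              exact hx
            rw [hgx, one_mul]
            exact hdens x ⟨by linarith [hx.1], by linarith [hx.2]⟩
      _ ≤ ∫ x, g x * f x := by
          rw [intervalIntegral.integral_of_le (by linarith)]
          exact setIntegral_le_integral hgf (Eventually.of_forall hnn)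
      _ ≤ ν.real (Ioo a b) := heq ▸ hup
  have hlim : Tendsto (fun r => κ * (p * Real.log (((a + b) / 2 + r) / ((a + b) / 2 - r))))
      (𝓝[<] ((b - a) / 2)) (𝓝 (κ * (p * Real.log (b / a)))) := by
    have h1 : (a + b) / 2 - (b - a) / 2 ≠ 0 := by
      rw [show (a + b) / 2 - (b - a) / 2 = a by ring]
      exact ha.ne'
    have h2 : ((a + b) / 2 + (b - a) / 2) / ((a + b) / 2 - (b - a) / 2) = b / a := by
      congr 1 <;> ring
    have h3 : ContinuousAt
        (fun r => κ * (p * Real.log (((a + b) / 2 + r) / ((a + b) / 2 - r)))) ((b - a) / 2) := by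
      refine continuousAt_const.mul (continuousAt_const.mul (ContinuousAt.log ?_ ?_))
      · exact ContinuousAt.div (by fun_prop) (by fun_prop) h1
      · rw [h2]
        exact (div_pos (ha.trans hab) ha).ne'
    have h4 := h3.tendsto
    rw [h2] at h4
    exact h4.mono_left nhdsWithin_le_nhds
  refine le_of_tendsto hlim ?_
  filter_upwards [Ioo_mem_nhdsLT (show (0 : ℝ) < (b - a) / 2 by linarith)] with r hr
  exact key r hr.1 hr.2

-- In the variable $v=x^p$ the factor $p$ cancels: $p\log(b/a)=\log(v'/v)\ge1-v/v'$. Positive $x$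
-- alone supply the mass.
open Set in
theorem le_measureReal_abs_rpow_of_charFun_eq {p c v v' : ℝ} {ν : Measure ℝ}
    [IsProbabilityMeasure ν] (hp : 0 < p) (hp1 : p < 1) (hc : 0 < c)
    (hν : ∀ t, charFun ν t = (Real.exp (-(c * |t| ^ p)) : ℝ)) (hvv : v < v')
    (hv : c / 20 ≤ v) (hv' : v' ≤ 20 * c) :
    stableDensityBound * (1 - v / v') ≤ ν.real {x | v < |x| ^ p ∧ |x| ^ p < v'} := by
  have hv0 : 0 < v := by linarith [div_pos hc (show (0 : ℝ) < 20 by norm_num)]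
  have hv0' : 0 < v' := hv0.trans hvv
  have e : ∀ u : ℝ, 0 < u → (u ^ p⁻¹) ^ p = u := fun u hu => Real.rpow_inv_rpow hu.le hp.ne'
  have h := le_measureReal_Ioo_of_charFun_eq hp hp1 hc hν (a := v ^ p⁻¹) (b := v' ^ p⁻¹)
    (by positivity) (Real.rpow_lt_rpow hv0.le hvv (by positivity))
    (by rw [e v' hv0', div_le_div_iff₀ (by norm_num) hv0']; linarith)
    (by rw [e v hv0, div_le_iff₀ hv0]; linarith)
  have h2 : 1 - v / v' ≤ p * Real.log (v' ^ p⁻¹ / v ^ p⁻¹) := by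
    rw [← Real.div_rpow hv0'.le hv0.le, Real.log_rpow (by positivity), ← mul_assoc,
      mul_inv_cancel₀ hp.ne', one_mul]
    have := Real.one_sub_inv_le_log_of_pos (div_pos hv0' hv0)
    rwa [inv_div] at this
  refine (mul_le_mul_of_nonneg_left h2 stableDensityBound_pos.le).trans (h.trans ?_)
  refine measureReal_mono fun x hx => ?_
  have hx0 : 0 < x := lt_of_le_of_lt (by positivity) hx.1
  rw [mem_ofPred_eq, abs_of_pos hx0]
  constructor
  · rw [← e v hv0]
    exact Real.rpow_lt_rpow (by positivity) hx.1 hp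
  · rw [← e v' hv0']
    exact Real.rpow_lt_rpow hx0.le hx.2 hp

/-! ### Tail bounds that locate the median -/

-- The tail beyond $R$ is controlled by $1-\varphi$ on $|t|\le2/R$. The choice $R^p=16c$ keeps
-- $c|t|^p\le1/8$ there, because $2^p\le2$.
open Set in
theorem measureReal_abs_rpow_gt_le_of_charFun_eq {p c : ℝ} {ν : Measure ℝ}
    [IsProbabilityMeasure ν] (hp : 0 < p) (hp1 : p < 1) (hc : 0 < c)
    (hν : ∀ t, charFun ν t = (Real.exp (-(c * |t| ^ p)) : ℝ)) :
    ν.real {x | 16 * c < |x| ^ p} ≤ 1 / 4 := by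
  have hR : 0 < (16 * c) ^ p⁻¹ := by positivity
  have hRp : ((16 * c) ^ p⁻¹) ^ p = 16 * c := Real.rpow_inv_rpow (by positivity) hp.ne'
  set R := (16 * c) ^ p⁻¹
  have hset : {x : ℝ | 16 * c < |x| ^ p} = {x | R < |x|} := by
    ext x
    rw [mem_ofPred_eq, mem_ofPred_eq, ← hRp, Real.rpow_lt_rpow_iff hR.le (abs_nonneg x) hp]
  rw [hset]
  refine (measureReal_abs_gt_le_integral_charFun hR).trans ?_
  have hb : ‖∫ t in (-2 * R⁻¹)..(2 * R⁻¹), 1 - charFun ν t‖ ≤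
      1 / 8 * |2 * R⁻¹ - (-2 * R⁻¹)| := by
    refine intervalIntegral.norm_integral_le_of_norm_le_const fun t ht => ?_
    rw [uIoc_of_le (by have := inv_pos.2 hR; linarith)] at ht
    have ht' : |t| ≤ 2 / R := by
      rw [abs_le, div_eq_mul_inv]
      constructor <;> linarith [ht.1, ht.2]
    have h2 : c * |t| ^ p ≤ 1 / 8 := by
      have h3 : |t| ^ p ≤ (2 / R) ^ p := Real.rpow_le_rpow (abs_nonneg t) ht' hp.le
      rw [Real.div_rpow two_pos.le hR.le, hRp] at h3
      have h4 : (2 : ℝ) ^ p ≤ 2 := by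
        simpa using Real.rpow_le_rpow_of_exponent_le one_le_two hp1.le
      calc c * |t| ^ p ≤ c * (2 / (16 * c)) := by
            gcongr
            exact h3.trans (by gcongr)
        _ = 1 / 8 := by field_simp; norm_num
    rw [hν, ← Complex.ofReal_one, ← Complex.ofReal_sub, Complex.norm_real, Real.norm_eq_abs,
      abs_of_nonneg]
    · linarith [Real.add_one_le_exp (-(c * |t| ^ p))]
    · rw [sub_nonneg, Real.exp_le_one_iff]
      have : 0 ≤ c * |t| ^ p := by positivity
      linarith
  calc 2⁻¹ * R * ‖∫ t in (-2 * R⁻¹)..(2 * R⁻¹), 1 - charFun ν t‖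
      ≤ 2⁻¹ * R * (1 / 8 * |2 * R⁻¹ - (-2 * R⁻¹)|) := by gcongr
    _ = 1 / 4 := by
      rw [show 2 * R⁻¹ - (-2 * R⁻¹) = 4 * R⁻¹ by ring, abs_of_pos (by positivity)]
      field_simp
      norm_num

theorem neg_one_third_le_sinc (y : ℝ) : -(1 / 3) ≤ Real.sinc y := by
  rcases eq_or_ne y 0 with rfl | hy
  · norm_num
  have h : Real.sinc y = Real.sinc |y| := by
    rcases abs_choice y with h | h <;> rw [h]
    rw [Real.sinc_neg]
  have hy' : 0 < |y| := abs_pos.2 hy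
  rw [h, Real.sinc_of_ne_zero hy'.ne', le_div_iff₀ hy']
  rcases le_total |y| 3 with h3 | h3
  · have := Real.sin_nonneg_of_nonneg_of_le_pi hy'.le (h3.trans Real.pi_gt_three.le)
    linarith
  · linarith [Real.neg_one_le_sin |y|]

theorem five_sixths_le_sinc {y : ℝ} (hy : |y| ≤ 1) : 5 / 6 ≤ Real.sinc y := by
  rcases eq_or_ne y 0 with rfl | hy0
  · norm_num
  have h : Real.sinc y = Real.sinc |y| := by
    rcases abs_choice y with h | h <;> rw [h]
    rw [Real.sinc_neg]
  have hy' : 0 < |y| := abs_pos.2 hy0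
  rw [h, Real.sinc_of_ne_zero hy'.ne', le_div_iff₀ hy']
  have := Real.sin_gt_sub_cube hy'
  nlinarith [mul_le_mul hy hy hy'.le zero_le_one]

-- $E\,\mathrm{sinc}(X/R)$ is the mean of $\varphi$ over $[-1/R,1/R]$. With $R^p=c/8$ one has
-- $c|t|^p=8(R|t|)^p\ge8R|t|$ there, so the mean is at most $\int_0^1e^{-8u}\,du\le1/8$. The
-- pointwise bounds on sinc make it at least $\frac76P(|X|\le R)-\frac13$, whence $P(|X|\le
-- R)\le11/28$.
open Set in
theorem measureReal_abs_rpow_le_of_charFun_eq {p c : ℝ} {ν : Measure ℝ}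
    [IsProbabilityMeasure ν] (hp : 0 < p) (hp1 : p < 1) (hc : 0 < c)
    (hν : ∀ t, charFun ν t = (Real.exp (-(c * |t| ^ p)) : ℝ)) :
    ν.real {x | |x| ^ p ≤ c / 8} < 1 / 2 := by
  have hR : 0 < (c / 8) ^ p⁻¹ := by positivity
  have hRp : ((c / 8) ^ p⁻¹) ^ p = c / 8 := Real.rpow_inv_rpow (by positivity) hp.ne'
  set R := (c / 8) ^ p⁻¹
  have hset : {x : ℝ | |x| ^ p ≤ c / 8} = {x | |x| ≤ R} := by
    ext x
    rw [mem_ofPred_eq, mem_ofPred_eq, ← hRp, Real.rpow_le_rpow_iff (abs_nonneg x) hR.le hp]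
  rw [hset]
  have hT : 0 < R⁻¹ := inv_pos.2 hR
  have hmeas : MeasurableSet {x : ℝ | |x| ≤ R} := measurableSet_le (by fun_prop) (by fun_prop)
  have hsinc : Integrable (fun x => Real.sinc (R⁻¹ * x)) ν :=
    Integrable.of_bound (by fun_prop) 1 (Filter.Eventually.of_forall fun x => by
      simpa using Real.abs_sinc_le_one (R⁻¹ * x))
  have hlow : 7 / 6 * ν.real {x | |x| ≤ R} - 1 / 3 ≤ ∫ x, Real.sinc (R⁻¹ * x) ∂ν := by
    have h1 : ∫ x, ({x : ℝ | |x| ≤ R}.indicator (fun _ => (7 / 6 : ℝ)) x - 1 / 3) ∂ν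
        = 7 / 6 * ν.real {x | |x| ≤ R} - 1 / 3 := by
      rw [integral_sub ((integrable_const _).indicator hmeas) (integrable_const _),
        integral_indicator_const _ hmeas]
      simp [mul_comm]
    rw [← h1]
    refine integral_mono (((integrable_const _).indicator hmeas).sub (integrable_const _)) hsinc
      fun x => ?_
    by_cases hx : |x| ≤ R
    · have h2 : |R⁻¹ * x| ≤ 1 := by
        rw [abs_mul, abs_of_pos hT, inv_mul_le_iff₀ hR, mul_one]
        exact hx
      have h3 := five_sixths_le_sinc h2
      simp only [indicator_of_mem (show x ∈ {x : ℝ | |x| ≤ R} from hx)]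
      linarith
    · simp only [indicator_of_notMem (show x ∉ {x : ℝ | |x| ≤ R} from hx)]
      linarith [neg_one_third_le_sinc (R⁻¹ * x)]
  have hI : 2 * R⁻¹ * ∫ x, Real.sinc (R⁻¹ * x) ∂ν
      = ∫ t in -R⁻¹..R⁻¹, Real.exp (-(c * |t| ^ p)) := by
    have := integral_charFun_Icc (μ := ν) hT
    simp only [hν] at this
    rw [intervalIntegral.integral_ofReal] at this
    exact_mod_cast this.symm
  have hcontp : Continuous fun t : ℝ => |t| ^ p :=
    (Real.continuous_rpow_const hp.le).comp continuous_abs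
  have hcont : Continuous fun t : ℝ => Real.exp (-(c * |t| ^ p)) := by fun_prop
  have hhalf : ∫ t in (0 : ℝ)..R⁻¹, Real.exp (-(c * |t| ^ p)) ≤ R⁻¹ / 8 := by
    have hle : ∫ t in (0 : ℝ)..R⁻¹, Real.exp (-(c * |t| ^ p)) ≤
        ∫ t in (0 : ℝ)..R⁻¹, Real.exp (-(8 * R) * t) := by
      refine intervalIntegral.integral_mono_on hT.le (hcont.intervalIntegrable _ _)
        ((by fun_prop : Continuous fun t : ℝ => Real.exp (-(8 * R) * t)).intervalIntegrable _ _)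
        fun t ht => ?_
      gcongr
      rw [neg_mul, neg_le_neg_iff, abs_of_nonneg ht.1]
      have hRt : R * t ≤ 1 := by
        calc R * t ≤ R * R⁻¹ := by gcongr; exact ht.2
          _ = 1 := mul_inv_cancel₀ hR.ne'
      have h1 : R * t ≤ (R * t) ^ p :=
        Real.self_le_rpow_of_le_one (mul_nonneg hR.le ht.1) hRt hp1.le
      rw [Real.mul_rpow hR.le ht.1, hRp] at h1
      linarith
    refine hle.trans ?_
    have h8R : -(8 * R) ≠ 0 := by
      have := hR.ne'
      simpa using this
    rw [intervalIntegral.integral_comp_mul_left (fun u => Real.exp u) h8R, integral_exp, mul_zero,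
      Real.exp_zero, smul_eq_mul, inv_neg, mul_inv]
    have := mul_pos hT (Real.exp_pos (-(8 * R) * R⁻¹))
    linarith
  have heven : ∫ t in -R⁻¹..R⁻¹, Real.exp (-(c * |t| ^ p))
      = 2 * ∫ t in (0 : ℝ)..R⁻¹, Real.exp (-(c * |t| ^ p)) := by
    rw [← intervalIntegral.integral_add_adjacent_intervals (b := 0)
      (hcont.intervalIntegrable _ _) (hcont.intervalIntegrable _ _), two_mul]
    congr 1
    have := intervalIntegral.integral_comp_neg (a := 0) (b := R⁻¹)
      (fun t : ℝ => Real.exp (-(c * |t| ^ p)))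
    simpa using this.symm
  have h8 : ∫ x, Real.sinc (R⁻¹ * x) ∂ν ≤ 1 / 8 := by
    have : 2 * R⁻¹ * ∫ x, Real.sinc (R⁻¹ * x) ∂ν ≤ 2 * R⁻¹ * (1 / 8) := by
      rw [hI, heven]
      linarith
    exact le_of_mul_le_mul_left this (by positivity)
  linarith

/-! ### The median of a stable law -/

-- Mass of order $\varepsilon$ lies strictly between the median and $(1\pm\varepsilon/8)$ times it.
-- The intermediate points $(1\pm\varepsilon/16)m$ avoid deciding whether the infimum defining the
-- median is attained.
open Set in
theorem IsPStable.absPowMedian_bounds {p : ℝ} {ν : Measure ℝ} [IsProbabilityMeasure ν]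
    (hp : 0 < p) (hp1 : p < 1) (h : IsPStable p ν) (hν : ν ≠ Measure.dirac 0) :
    0 < absPowMedian p ν ∧ ∀ ε, 0 < ε → ε < 1 →
      ν.real {x | (1 + ε / 8) * absPowMedian p ν < |x| ^ p} ≤
          1 / 2 - stableDensityBound / 18 * ε ∧
        ν.real {x | |x| ^ p < (1 - ε / 8) * absPowMedian p ν} ≤
          1 / 2 - stableDensityBound / 18 * ε := by
  obtain ⟨c, hc, hφ⟩ := h.exists_charFun_eq hp hν
  set m := absPowMedian p ν with hm
  have hκ := stableDensityBound_pos
  set κ := stableDensityBound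
  have hcont : Continuous fun x : ℝ => |x| ^ p :=
    (Real.continuous_rpow_const hp.le).comp continuous_abs
  have hup := measureReal_abs_rpow_gt_le_of_charFun_eq hp hp1 hc hφ
  have hlo := measureReal_abs_rpow_le_of_charFun_eq hp hp1 hc hφ
  have hcompl : ∀ t, ν.real {x | |x| ^ p ≤ t} = 1 - ν.real {x | t < |x| ^ p} := fun t => by
    rw [← probReal_compl_eq_one_sub (measurableSet_lt measurable_const hcont.measurable)]
    congr 1
    ext x
    simp
  have hmem : ∀ t, 1 / 2 ≤ ν.real {x | |x| ^ p ≤ t} → c / 8 ≤ t := fun t ht => by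
    by_contra! hlt
    have : ν.real {x | |x| ^ p ≤ t} ≤ ν.real {x | |x| ^ p ≤ c / 8} :=
      measureReal_mono fun x (hx : |x| ^ p ≤ t) => hx.trans hlt.le
    linarith
  have h16 : 1 / 2 ≤ ν.real {x | |x| ^ p ≤ 16 * c} := by
    rw [hcompl]
    linarith
  have hm1 : c / 8 ≤ m := le_csInf ⟨_, h16⟩ hmem
  have hm2 : m ≤ 16 * c := csInf_le ⟨c / 8, hmem⟩ h16
  have hm0 : 0 < m := by linarith
  refine ⟨hm0, fun ε hε hε1 => ⟨?_, ?_⟩⟩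
  · have hgap := le_measureReal_abs_rpow_of_charFun_eq (v := (1 + ε / 16) * m)
      (v' := (1 + ε / 8) * m) hp hp1 hc hφ (by nlinarith) (by nlinarith) (by nlinarith)
    -- The ratio gap is $(\varepsilon/16)/(1+\varepsilon/8)$, and $16\cdot\frac98=18$.
    have h1 : ε / 18 ≤ 1 - (1 + ε / 16) * m / ((1 + ε / 8) * m) := by
      rw [mul_div_mul_right _ _ hm0.ne', le_sub_comm, div_le_iff₀ (by linarith)]
      nlinarith
    have h2 : 1 / 2 ≤ ν.real {x | |x| ^ p ≤ (1 + ε / 16) * m} := by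
      have hlt : m < (1 + ε / 16) * m := by nlinarith
      obtain ⟨t, ht, htm⟩ := exists_lt_of_csInf_lt
        (s := {t : ℝ | 1 / 2 ≤ ν.real {x | |x| ^ p ≤ t}}) ⟨_, h16⟩ hlt
      exact le_trans ht (measureReal_mono fun x (hx : |x| ^ p ≤ t) => hx.trans htm.le)
    have h3 : ν.real {x | (1 + ε / 8) * m < |x| ^ p}
        + ν.real {x | (1 + ε / 16) * m < |x| ^ p ∧ |x| ^ p < (1 + ε / 8) * m}
        ≤ ν.real {x | (1 + ε / 16) * m < |x| ^ p} := by
      rw [← measureReal_union]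
      · refine measureReal_mono fun x hx => ?_
        rcases hx with hx | hx
        · have hx : (1 + ε / 8) * m < |x| ^ p := hx
          exact lt_trans (by nlinarith) hx
        · exact hx.1
      · refine disjoint_left.2 fun x hx hx' => ?_
        exact lt_asymm hx hx'.2
      · exact (measurableSet_lt measurable_const hcont.measurable).inter
          (measurableSet_lt hcont.measurable measurable_const)
    rw [hcompl] at h2
    have h4 := mul_le_mul_of_nonneg_left h1 hκ.le
    linarith
  · have hgap := le_measureReal_abs_rpow_of_charFun_eq (v := (1 - ε / 8) * m)
      (v' := (1 - ε / 16) * m) hp hp1 hc hφ (by nlinarith) (by nlinarith) (by nlinarith)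
    have h1 : ε / 18 ≤ 1 - (1 - ε / 8) * m / ((1 - ε / 16) * m) := by
      rw [mul_div_mul_right _ _ hm0.ne', le_sub_comm, div_le_iff₀ (by linarith)]
      nlinarith
    have h2 : ν.real {x | |x| ^ p ≤ (1 - ε / 16) * m} < 1 / 2 := by
      have hlt : (1 - ε / 16) * m < m := by nlinarith
      by_contra! hle
      exact absurd (csInf_le ⟨c / 8, hmem⟩ hle) (not_le.2 hlt)
    have h3 : ν.real {x | |x| ^ p < (1 - ε / 8) * m}
        + ν.real {x | (1 - ε / 8) * m < |x| ^ p ∧ |x| ^ p < (1 - ε / 16) * m}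
        ≤ ν.real {x | |x| ^ p ≤ (1 - ε / 16) * m} := by
      rw [← measureReal_union]
      · refine measureReal_mono fun x hx => ?_
        rcases hx with hx | hx
        · have hx : |x| ^ p < (1 - ε / 8) * m := hx
          exact le_trans hx.le (by nlinarith)
        · exact hx.2.le
      · refine disjoint_left.2 fun x hx hx' => ?_
        exact lt_asymm hx hx'.1
      · exact (measurableSet_lt measurable_const hcont.measurable).inter
          (measurableSet_lt hcont.measurable measurable_const)
    have h4 := mul_le_mul_of_nonneg_left h1 hκ.le
    linarith

/-! ### Sample medians -/

/-- Sorting turns a downward closed condition on an order statistic into a count. A general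
predicate covers both $\le t$ and $<t$; the index $(r-1)/2$ is zero-based, so the inequality with
the count is strict. -/
theorem sampleMedian_iff_card {r : ℕ} (hr : 0 < r) (x : Fin r → ℝ) (P : ℝ → Prop)
    [DecidablePred P] (hP : ∀ a b, a ≤ b → P b → P a) :
    P (sampleMedian x) ↔ (r - 1) / 2 < (Finset.univ.filter fun j => P (x j)).card := by
  set k : Fin r := ⟨(r - 1) / 2, by omega⟩ with hk
  have hmed : sampleMedian x = x (Tuple.sort x k) := by rw [sampleMedian, dif_pos hr]
  have hmono := Tuple.monotone_sort x
  rw [hmed]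
  constructor
  · intro h
    have hsub : (Finset.Iic k).map (Tuple.sort x).toEmbedding ⊆
        Finset.univ.filter fun j => P (x j) := by
      intro j hj
      obtain ⟨i, hi, rfl⟩ := Finset.mem_map.1 hj
      exact Finset.mem_filter.2 ⟨Finset.mem_univ _, hP _ _ (hmono (Finset.mem_Iic.1 hi)) h⟩
    have := Finset.card_le_card hsub
    rw [Finset.card_map, Fin.card_Iic] at this
    exact this
  · intro h
    by_contra hn
    have hsub : (Finset.univ.filter fun j => P (x j)) ⊆
        (Finset.Iio k).map (Tuple.sort x).toEmbedding := by
      intro j hj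
      refine Finset.mem_map.2 ⟨(Tuple.sort x).symm j, Finset.mem_Iio.2 ?_, by simp⟩
      by_contra hle
      refine hn (hP _ _ (hmono (not_lt.1 hle)) ?_)
      simpa using (Finset.mem_filter.1 hj).2
    have := Finset.card_le_card hsub
    rw [Finset.card_map, Fin.card_Iio] at this
    exact absurd h (not_lt.2 this)

theorem sampleMedian_le_iff {r : ℕ} (hr : 0 < r) (x : Fin r → ℝ) (t : ℝ) :
    sampleMedian x ≤ t ↔ (r - 1) / 2 < (Finset.univ.filter fun j => x j ≤ t).card :=
  sampleMedian_iff_card hr x (· ≤ t) fun _ _ h h' => h.trans h'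

theorem sampleMedian_le_add {r : ℕ} (hr : 0 < r) {x y : Fin r → ℝ} {ξ : ℝ}
    (h : ∀ j, x j ≤ y j + ξ) : sampleMedian x ≤ sampleMedian y + ξ := by
  rw [sampleMedian_le_iff hr]
  refine ((sampleMedian_le_iff hr y _).1 le_rfl).trans_le (Finset.card_le_card ?_)
  intro j hj
  have := (Finset.mem_filter.1 hj).2
  exact Finset.mem_filter.2 ⟨Finset.mem_univ _, (h j).trans (by gcongr)⟩

theorem measurable_sampleMedian {r : ℕ} : Measurable (sampleMedian : (Fin r → ℝ) → ℝ) := by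
  rcases Nat.eq_zero_or_pos r with rfl | hr
  · have : (sampleMedian : (Fin 0 → ℝ) → ℝ) = fun _ => 0 := by
      ext x
      simp [sampleMedian]
    rw [this]
    exact measurable_const
  · refine measurable_of_Iic fun t => ?_
    have : sampleMedian ⁻¹' Set.Iic t = {x : Fin r → ℝ | ((r - 1) / 2 : ℕ) <
        ∑ j, Set.indicator {y : ℝ | y ≤ t} (fun _ => 1) (x j)} := by
      ext x
      rw [Set.mem_preimage, Set.mem_Iic, sampleMedian_le_iff hr, Finset.card_filter]
      simp [Set.indicator_apply]
    rw [this]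
    refine measurableSet_lt measurable_const (Finset.measurable_sum _ fun j _ => ?_)
    exact (measurable_const.indicator (measurableSet_le measurable_id measurable_const)).comp
      (measurable_pi_apply j)

open ProbabilityTheory in
/-- Hoeffding's inequality for the number of independent variables that lie in a set. -/
theorem measureReal_pi_half_le_card_le {r : ℕ} (hr : 0 < r) {ρ : Measure ℝ} [IsProbabilityMeasure ρ]
    {B : Set ℝ} [DecidablePred (· ∈ B)] (hB : MeasurableSet B) {θ : ℝ} (hθ : 0 ≤ θ)
    (h : ρ.real B ≤ 1 / 2 - θ) :
    (Measure.pi fun _ : Fin r => ρ).real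
        {z | (r : ℝ) / 2 ≤ (Finset.univ.filter fun j => z j ∈ B).card} ≤
      Real.exp (-(2 * r * θ ^ 2)) := by
  set μ := Measure.pi fun _ : Fin r => ρ
  let Y : ℝ → ℝ := B.indicator fun _ => 1
  have hY : Measurable Y := measurable_const.indicator hB
  have hYm : ∀ᵐ y ∂ρ, Y y ∈ Set.Icc 0 1 := Filter.Eventually.of_forall fun y => by
    by_cases hy : y ∈ B <;> simp [Y, hy]
  have hEY : ρ[Y] = ρ.real B := by
    exact integral_indicator_one (μ := ρ) hB
  have hind : iIndepFun (fun (j : Fin r) (z : Fin r → ℝ) => Y (z j) - ρ[Y]) μ :=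
    iIndepFun_pi fun _ => (hY.sub_const _).aemeasurable
  have hsub : ∀ j ∈ (Finset.univ : Finset (Fin r)), HasSubgaussianMGF
      (fun z : Fin r → ℝ => Y (z j) - ρ[Y]) ((‖(1 : ℝ) - 0‖₊ / 2) ^ 2) μ := fun j _ => by
    have hmp := measurePreserving_eval (fun _ : Fin r => ρ) j
    have := hasSubgaussianMGF_of_mem_Icc hY.aemeasurable hYm
    rw [← hmp.map_eq] at this
    have h2 := this.of_map hmp.measurable.aemeasurable
    rw [hmp.map_eq] at h2
    exact h2
  have hr' : (0 : ℝ) < r := by exact_mod_cast hr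
  have key := HasSubgaussianMGF.measure_sum_ge_le_of_iIndepFun hind hsub
    (ε := r * θ) (by positivity)
  refine le_trans (measureReal_mono fun z hz => ?_) (key.trans (le_of_eq ?_))
  · have hz : (r : ℝ) / 2 ≤ (Finset.univ.filter fun j => z j ∈ B).card := hz
    have hcard : ((Finset.univ.filter fun j => z j ∈ B).card : ℝ) = ∑ j, Y (z j) := by
      rw [Finset.card_filter]
      push_cast
      refine Finset.sum_congr rfl fun j _ => ?_
      simp [Y, Set.indicator_apply]
    have : (r : ℝ) * θ ≤ ∑ j, (Y (z j) - ρ[Y]) := by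
      rw [Finset.sum_sub_distrib, ← hcard, hEY]
      simp only [Finset.sum_const, Finset.card_univ, Fintype.card_fin, nsmul_eq_mul]
      nlinarith
    exact this
  · congr 1
    simp
    field_simp

/-! ### The law of a sketch -/

/-- The matrix law is a product over rows, but stability acts on columns, which must be seen as
independent. -/
theorem map_swap_pi_pi {ι κ : Type*} [Fintype ι] [Fintype κ] (ν : Measure ℝ)
    [IsProbabilityMeasure ν] :
    (Measure.pi fun _ : ι => Measure.pi fun _ : κ => ν).map (fun X j i => X i j) =
      Measure.pi fun _ : κ => Measure.pi fun _ : ι => ν := by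
  have h1 := Measure.infinitePi_map_curry_symm (fun (_ : ι) (_ : κ) => ν)
  have h2 := Measure.infinitePi_map_piCongrLeft (fun _ : κ × ι => ν) (Equiv.prodComm ι κ)
  have h3 := Measure.infinitePi_map_curry (fun (_ : κ) (_ : ι) => ν)
  simp only [Measure.infinitePi_eq_pi] at h1 h2 h3
  rw [← h3, ← h2, ← h1, Measure.map_map (by fun_prop) (by fun_prop),
    Measure.map_map (by fun_prop) (by fun_prop)]
  congr 1

theorem IsPStable.map_pi {p : ℝ} {ν : Measure ℝ} [IsProbabilityMeasure ν] (h : IsPStable p ν)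
    {U : Type*} [Fintype U] (a : U → ℝ) :
    (Measure.pi fun _ : U => ν).map (fun x => ∑ i, a i * x i) =
      ν.map (fun y => (∑ i, |a i| ^ p) ^ (1 / p) * y) := by
  let e := Fintype.equivFin U
  have h1 := h (Fintype.card U) (fun k => a (e.symm k))
  have h2 := (measurePreserving_piCongrLeft (fun _ : Fin (Fintype.card U) => ν) e).map_eq
  rw [← h2, Measure.map_map (by fun_prop) (by fun_prop)] at h1
  rw [e.symm.sum_comp (fun i => |a i| ^ p)] at h1
  rw [← h1]
  congr 1
  ext x
  rw [Function.comp_apply, ← e.sum_comp]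
  refine Finset.sum_congr rfl fun i _ => ?_
  rw [Equiv.symm_apply_apply]
  congr 1
  exact (MeasurableEquiv.piCongrLeft_apply_apply (β := fun _ => ℝ) e x i).symm

theorem IsPStable.map_sketch {p : ℝ} {ν : Measure ℝ} [IsProbabilityMeasure ν] (h : IsPStable p ν)
    {U : Type*} [Fintype U] (a : U → ℝ) (r : ℕ) :
    (Measure.pi fun _ : U => Measure.pi fun _ : Fin r => ν).map
        (fun X j => ∑ i, a i * X i j) =
      Measure.pi fun _ : Fin r => ν.map (fun y => (∑ i, |a i| ^ p) ^ (1 / p) * y) := by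
  have hm : Measurable fun x : U → ℝ => ∑ i, a i * x i :=
    Finset.measurable_sum _ fun i _ => (measurable_pi_apply i).const_mul _
  have : ∀ j : Fin r, IsProbabilityMeasure
      ((Measure.pi fun _ : U => ν).map (fun x => ∑ i, a i * x i)) := fun _ =>
    Measure.isProbabilityMeasure_map hm.aemeasurable
  rw [← h.map_pi a, ← Measure.pi_map_pi (fun _ => hm.aemeasurable), ← map_swap_pi_pi,
    Measure.map_map (by fun_prop) (by fun_prop)]
  rfl

/-! ### Laplace noise -/

open Set in
theorem laplaceMeasure_one_Ioi {L : ℝ} (hL : 0 ≤ L) :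
    laplaceMeasure 1 (Ioi L) = ENNReal.ofReal (Real.exp (-L) / 2) := by
  rw [laplaceMeasure, withDensity_apply _ measurableSet_Ioi]
  have h1 : ∫⁻ x in Ioi L, ENNReal.ofReal (1 / (2 * 1) * Real.exp (-|x| / 1))
      = ∫⁻ x in Ioi L, ENNReal.ofReal (1 / 2 * Real.exp (-x)) := by
    refine setLIntegral_congr_fun measurableSet_Ioi fun x hx => ?_
    simp only [mul_one, div_one, abs_of_pos (hL.trans_lt hx)]
  rw [h1, ← ofReal_integral_eq_lintegral_ofReal ((integrableOn_exp_neg_Ioi L).const_mul _)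
    (Filter.Eventually.of_forall fun x => by positivity), integral_const_mul, integral_exp_neg_Ioi]
  ring_nf

open Set in
theorem laplaceMeasure_one_Iic {L : ℝ} (hL : 0 ≤ L) :
    laplaceMeasure 1 (Iic (-L)) = ENNReal.ofReal (Real.exp (-L) / 2) := by
  rw [laplaceMeasure, withDensity_apply _ measurableSet_Iic]
  have h1 : ∫⁻ x in Iic (-L), ENNReal.ofReal (1 / (2 * 1) * Real.exp (-|x| / 1))
      = ∫⁻ x in Iic (-L), ENNReal.ofReal (1 / 2 * Real.exp x) := by
    refine setLIntegral_congr_fun measurableSet_Iic fun x hx => ?_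
    have hx : x ≤ -L := hx
    simp only [mul_one, div_one, abs_of_nonpos (by linarith : x ≤ 0), neg_neg]
  rw [h1, ← ofReal_integral_eq_lintegral_ofReal ((integrableOn_exp_Iic _).const_mul _)
    (Filter.Eventually.of_forall fun x => by positivity), integral_const_mul, integral_exp_Iic]
  ring_nf

instance isProbabilityMeasure_laplaceMeasure_one : IsProbabilityMeasure (laplaceMeasure 1) where
  measure_univ := by
    have h1 := laplaceMeasure_one_Ioi le_rfl
    have h2 := laplaceMeasure_one_Iic le_rfl
    rw [neg_zero] at h2
    rw [← Set.Iic_union_Ioi (a := (0 : ℝ)), measure_union (by simp) measurableSet_Ioi, h1, h2,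
      ← ENNReal.ofReal_add (by positivity) (by positivity)]
    norm_num

theorem laplaceMeasure_one_real_abs_gt_le {L : ℝ} (hL : 0 ≤ L) :
    (laplaceMeasure 1).real {y | L < |y|} ≤ Real.exp (-L) := by
  have hsub : {y : ℝ | L < |y|} ⊆ Set.Iic (-L) ∪ Set.Ioi L := fun y hy => by
    rcases lt_abs.1 (show L < |y| from hy) with h | h
    · exact Or.inr h
    · exact Or.inl (show y ≤ -L by linarith)
  refine (measureReal_mono hsub).trans ((measureReal_union_le _ _).trans ?_)
  rw [measureReal_def, measureReal_def, laplaceMeasure_one_Ioi hL, laplaceMeasure_one_Iic hL,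
    ENNReal.toReal_ofReal (by positivity)]
  linarith

/-- After translating Lebesgue measure, this is the pointwise density ratio $e^{|y|-|y'|}\le
e^{|y-y'|}$. -/
theorem map_add_laplaceMeasure_one_le (u : ℝ) :
    (laplaceMeasure 1).map (fun y => y + u) ≤ (Real.exp |u|).toNNReal • laplaceMeasure 1 := by
  refine Measure.le_iff.2 fun B hB => ?_
  rw [Measure.map_apply (by fun_prop) hB, Measure.smul_apply, laplaceMeasure,
    withDensity_apply _ hB, withDensity_apply _ (hB.preimage (by fun_prop)),
    ← lintegral_indicator hB, ← lintegral_indicator (hB.preimage (by fun_prop))]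
  rw [← lintegral_add_right_eq_self (μ := volume) _ (-u), ENNReal.smul_def, smul_eq_mul,
    ← lintegral_const_mul' _ _ ENNReal.coe_ne_top]
  refine lintegral_mono fun y => ?_
  by_cases hy : y ∈ B
  · rw [Set.indicator_of_mem hy, Set.indicator_of_mem (by simpa using hy)]
    change _ ≤ ENNReal.ofReal (Real.exp |u|) * _
    rw [← ENNReal.ofReal_mul (by positivity)]
    refine ENNReal.ofReal_le_ofReal ?_
    rw [mul_left_comm, ← Real.exp_add]
    gcongr
    have := abs_sub_abs_le_abs_sub y (y + -u)
    rw [show y - (y + -u) = u by ring] at this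
    linarith
  · rw [Set.indicator_of_notMem (by simpa using hy)]
    exact zero_le

open scoped NNReal in
theorem measure_pi_le_smul_pi {ι : Type*} [Fintype ι] {X : ι → Type*} [∀ i, MeasurableSpace (X i)]
    {μ ν : ∀ i, Measure (X i)} [∀ i, IsFiniteMeasure (μ i)] [∀ i, IsFiniteMeasure (ν i)]
    {c : ι → ℝ≥0} (h : ∀ i, μ i ≤ c i • ν i) :
    Measure.pi μ ≤ (∏ i, c i) • Measure.pi ν := by
  have h1 : (∏ i, c i) • Measure.pi ν = Measure.pi fun i => c i • ν i := by
    refine (Measure.pi_eq fun s _ => ?_).symm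
    rw [Measure.smul_apply, Measure.pi_pi]
    simp only [Measure.smul_apply, ENNReal.smul_def, smul_eq_mul, Finset.prod_mul_distrib,
      ENNReal.ofNNReal_finsetProd]
  rw [h1]
  -- The product outer measure is the largest one bounded by the products on boxes, so comparing
  -- boxes is enough.
  have h2 : (Measure.pi μ).toOuterMeasure ≤
      OuterMeasure.pi fun i => (c i • ν i).toOuterMeasure := by
    refine OuterMeasure.le_pi.2 fun s _ => ?_
    change Measure.pi μ (Set.univ.pi s) ≤ _
    rw [Measure.pi_pi]
    exact Finset.prod_le_prod' fun i _ => h i (s i)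
  refine Measure.le_iff.2 fun s hs => ?_
  refine (h2 s).trans (le_of_eq ?_)
  rw [Measure.pi, toMeasure_apply _ _ hs]

/-! ### The state of the noisy sketch -/

namespace UpdateStream

variable {U : Type*} [DecidableEq U]

theorem stateVec_eq_add (S : UpdateStream U) (K : Finset (Fin S.length)) (l : U) :
    S.stateVec l = S.sumOnAt K l + S.sumOnAt Kᶜ l := by
  simp only [stateVec, sumOnAt, Finset.sum_filter]
  exact (Finset.sum_add_sum_compl K _).symm

theorem sumOnAt_eq_ite {S : UpdateStream U} {K : Finset (Fin S.length)} {i : U}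
    (hK : ∀ k ∈ K, (S.get k).1 = i) (l : U) : S.sumOnAt K l = if l = i then S.sumOn K else 0 := by
  split_ifs with h
  · rw [sumOnAt, Finset.filter_true_of_mem fun k hk => (hK k hk).trans h.symm, sumOn]
  · rw [sumOnAt, Finset.filter_false_of_mem fun k hk hkl => h (hkl.symm.trans (hK k hk)),
      Finset.sum_empty]

/-- The sketch depends on a stream only through its state vector, so neighbours may be replaced by
two vectors with common remainder `ρ` and mass `s` at different places. -/
theorem NeighborBy.exists_stateVec_eq {S S' : UpdateStream U} {s : ℤ} (h : NeighborBy S S' s) :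
    ∃ (i j : U) (ρ : U → ℤ), i ≠ j ∧ (∀ l, S.stateVec l = (if l = i then s else 0) + ρ l) ∧
      (∀ l, S'.stateVec l = (if l = j then s else 0) + ρ l) ∧
      (S.CashRegister → 0 ≤ s ∧ ∀ l, 0 ≤ ρ l) := by
  obtain ⟨i, j, K, K', hij, hK, hK', hs, hs', hρ⟩ := h
  refine ⟨i, j, S.sumOnAt Kᶜ, hij, fun l => ?_, fun l => ?_, fun hS => ⟨?_, fun l => ?_⟩⟩
  · rw [stateVec_eq_add S K, sumOnAt_eq_ite hK, hs]
  · rw [stateVec_eq_add S' K', sumOnAt_eq_ite hK', hs', hρ]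
  · rw [← hs]
    exact Finset.sum_nonneg fun k _ => hS _ (List.get_mem S k)
  · exact Finset.sum_nonneg fun k _ => hS _ (List.get_mem S k)

/-- At $i$ the two state vectors are $s+\rho_i$ and $\rho_i$; $s$ is their difference. -/
theorem NeighborBy.abs_lt_two_mul {S S' : UpdateStream U} {s : ℤ} (h : NeighborBy S S' s) {Z : ℝ}
    (hS : S.BoundedBy Z) (hS' : S'.BoundedBy Z) : |(s : ℝ)| < 2 * Z := by
  obtain ⟨i, j, ρ, hij, h1, h2, -⟩ := h.exists_stateVec_eq
  have e1 : (S.stateVec i : ℝ) = s + ρ i := by simp [h1 i]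
  have e2 : (S'.stateVec i : ℝ) = ρ i := by simp [h2 i, hij]
  have b1 := abs_lt.1 (hS i)
  have b2 := abs_lt.1 (hS' i)
  rw [e1] at b1
  rw [e2] at b2
  rw [abs_lt]
  constructor <;> linarith [b1.1, b1.2, b2.1, b2.2]

/-- Without cancellation $0\le s\le s+\rho_i=a_i$, which saves the factor $2$ of the turnstile case.
-/
theorem NeighborBy.abs_lt_of_cashRegister {S S' : UpdateStream U} {s : ℤ} (h : NeighborBy S S' s)
    {Z : ℝ} (hS : S.BoundedBy Z) (hcr : S.CashRegister) : |(s : ℝ)| < Z := by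
  obtain ⟨i, j, ρ, hij, h1, -, h3⟩ := h.exists_stateVec_eq
  obtain ⟨hs, hρ⟩ := h3 hcr
  have e1 : (S.stateVec i : ℝ) = s + ρ i := by simp [h1 i]
  have b1 := hS i
  have hs' : (0 : ℝ) ≤ s := by exact_mod_cast hs
  have hρ' : (0 : ℝ) ≤ ρ i := by exact_mod_cast hρ i
  rw [e1, abs_of_nonneg (by positivity)] at b1
  rw [abs_of_nonneg hs']
  linarith

theorem foldl_add_eq {V : Type*} {r : ℕ} (S : UpdateStream V) (X : V → Fin r → ℝ)
    (c : Fin r → ℝ) (j : Fin r) :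
    (S.foldl (fun (c : Fin r → ℝ) (u : V × ℤ) j => c j + u.2 * X u.1 j) c) j =
      c j + (S.map fun u => (u.2 : ℝ) * X u.1 j).sum := by
  induction S generalizing c with
  | nil => simp
  | cons u S ih =>
    rw [List.foldl_cons, ih, List.map_cons, List.sum_cons]
    ring

theorem sum_map_mul_eq [Fintype U] (S : UpdateStream U) (f : U → ℝ) :
    (S.map fun u => (u.2 : ℝ) * f u.1).sum = ∑ i, (S.stateVec i : ℝ) * f i := by
  have h1 : (S.map fun u => (u.2 : ℝ) * f u.1).sum
      = ∑ k : Fin S.length, ((S.get k).2 : ℝ) * f (S.get k).1 := by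
    rw [← Fin.sum_univ_fun_getElem]
    rfl
  have h2 : ∀ i, (S.stateVec i : ℝ) * f i
      = ∑ k : Fin S.length, if (S.get k).1 = i then ((S.get k).2 : ℝ) * f i else 0 := fun i => by
    rw [stateVec, sumOnAt, Finset.sum_filter]
    push_cast
    rw [Finset.sum_mul]
    refine Finset.sum_congr rfl fun k _ => ?_
    split_ifs <;> simp
  rw [h1, Finset.sum_congr rfl fun i _ => h2 i, Finset.sum_comm]
  refine Finset.sum_congr rfl fun k _ => ?_
  simp

end UpdateStream

section NoisySketch

variable {U : Type*} {r : ℕ}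

theorem noisySketch_memory [Fintype U] [DecidableEq U] (α p W : ℝ) (ν : Measure ℝ) (S : UpdateStream U)
    (ω : SketchCoins U r) (j : Fin r) :
    (noisySketch U r α p W ν).memory S ω j =
      2 * W * colNorm ω.1 j / α * ω.2 j + ∑ i, (S.stateVec i : ℝ) * ω.1 i j := by
  rw [← UpdateStream.sum_map_mul_eq S fun i => ω.1 i j]
  exact UpdateStream.foldl_add_eq S ω.1 _ j

theorem abs_le_colNorm [Finite U] (X : U → Fin r → ℝ) (i : U) (j : Fin r) : |X i j| ≤ colNorm X j :=
  le_ciSup (f := fun i => |X i j|) (Set.finite_range _).bddAbove i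

theorem colNorm_nonneg (X : U → Fin r → ℝ) (j : Fin r) : 0 ≤ colNorm X j :=
  Real.iSup_nonneg fun _ => abs_nonneg _

theorem colNorm_le_maxColNorm (X : U → Fin r → ℝ) (j : Fin r) : colNorm X j ≤ maxColNorm X :=
  le_ciSup (f := fun j => colNorm X j) (Set.finite_range _).bddAbove j

theorem maxColNorm_nonneg (X : U → Fin r → ℝ) : 0 ≤ maxColNorm X :=
  Real.iSup_nonneg fun j => colNorm_nonneg X j

theorem measurable_noisySketch_run [Fintype U] [DecidableEq U] (α p W : ℝ) (ν : Measure ℝ)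
    (S : UpdateStream U) : Measurable ((noisySketch U r α p W ν).run S) := by
  have hcol : ∀ j : Fin r, Measurable fun ω : SketchCoins U r => colNorm ω.1 j := fun j =>
    Measurable.iSup fun i => by fun_prop
  have hmem : Measurable ((noisySketch U r α p W ν).memory S) := by
    refine measurable_pi_lambda _ fun j => ?_
    simp_rw [noisySketch_memory]
    have := hcol j
    refine Measurable.add (by fun_prop) (Finset.measurable_sum _ fun i _ => ?_)
    fun_prop
  have hout : Measurable fun c : Fin r → ℝ =>
      sampleMedian (fun j => |c j| ^ p) * scaleFactor p ν := by
    refine (measurable_sampleMedian.comp (measurable_pi_lambda _ fun j => ?_)).mul_const _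
    fun_prop
  exact (measurable_fst.prodMk hmem).prodMk (hout.comp hmem)

/-- Pan-privacy of the noisy sketch for replaced updates of total at most `W`. -/
theorem panPrivate_noisySketch [Fintype U] [DecidableEq U] {α p W : ℝ} (hα : 0 < α) (hW : 0 < W)
    (ν : Measure ℝ) [IsProbabilityMeasure ν] :
    (noisySketch U r α p W ν).PanPrivate (α * r) fun S S' =>
      ∃ s : ℤ, UpdateStream.NeighborBy S S' s ∧ |(s : ℝ)| ≤ W := by
  rintro S S' ⟨s, hN, hs⟩ E hE
  obtain ⟨i, i', ρ, -, h1, h2, -⟩ := hN.exists_stateVec_eq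
  set A := noisySketch U r α p W ν
  -- The change of counter $j$ in units of its noise scale; shifting the Laplace variables by it
  -- couples the two runs.
  let u : (U → Fin r → ℝ) → Fin r → ℝ := fun X j =>
    s * (X i j - X i' j) / (2 * W * colNorm X j / α)
  have hΔ : ∀ (X : U → Fin r → ℝ) (j : Fin r), ∑ l, (S.stateVec l : ℝ) * X l j
      = s * (X i j - X i' j) + ∑ l, (S'.stateVec l : ℝ) * X l j := fun X j => by
    have key : ∀ (T : UpdateStream U) (k : U),
        (∀ l, T.stateVec l = (if l = k then s else 0) + ρ l) →
        ∑ l, (T.stateVec l : ℝ) * X l j = s * X k j + ∑ l, (ρ l : ℝ) * X l j := fun T k hT => by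
      simp [hT, add_mul, Finset.sum_add_distrib]
    rw [key S i h1, key S' i' h2]
    ring
  have hΔle : ∀ (X : U → Fin r → ℝ) (j : Fin r),
      |s * (X i j - X i' j)| ≤ 2 * W * colNorm X j := fun X j => by
    rw [abs_mul]
    calc |(s : ℝ)| * |X i j - X i' j| ≤ W * (|X i j| + |X i' j|) := by
          gcongr
          exact abs_sub _ _
      _ ≤ W * (colNorm X j + colNorm X j) := by
          gcongr <;> exact abs_le_colNorm X _ j
      _ = _ := by ring
  have hu : ∀ X j, |u X j| ≤ α := fun X j => by
    have hn : 0 ≤ 2 * W * colNorm X j / α := by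
      have := colNorm_nonneg X j
      positivity
    rw [abs_div, abs_of_nonneg hn]
    refine div_le_of_le_mul₀ hn hα.le ?_
    rw [mul_div_cancel₀ _ hα.ne']
    exact hΔle X j
  have hmem : ∀ X Y, A.memory S (X, Y) = A.memory S' (X, fun j => Y j + u X j) := fun X Y => by
    ext j
    rw [noisySketch_memory, noisySketch_memory, hΔ, mul_add, add_assoc]
    congr 2
    -- A zero column gives zero noise scale, but the counter then does not change either, so
    -- division by zero is harmless.
    rcases (colNorm_nonneg X j).eq_or_lt with h0 | h0
    · have := hΔle X j
      rw [← h0, mul_zero] at this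
      simp only [← h0, mul_zero, zero_div, zero_mul]
      exact abs_nonpos_iff.1 this
    · have : 2 * W * colNorm X j / α ≠ 0 := by positivity
      exact (mul_div_cancel₀ _ this).symm
  have hrun : ∀ X Y, A.run S (X, Y) = A.run S' (X, fun j => Y j + u X j) := fun X Y => by
    simp only [StreamAlgorithm.run, StreamAlgorithm.result, hmem]
    rfl
  have hm := measurable_noisySketch_run (r := r) α p W ν S hE
  have hm' := measurable_noisySketch_run (r := r) α p W ν S' hE
  change sketchLaw U r ν (A.run S ⁻¹' E) ≤ _ * sketchLaw U r ν (A.run S' ⁻¹' E)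
  rw [sketchLaw, Measure.prod_apply hm, Measure.prod_apply hm',
    ← lintegral_const_mul' _ _ ENNReal.ofReal_ne_top]
  -- The random table has the same law in both runs, so it suffices to compare the fibres over a
  -- fixed $X$.
  refine lintegral_mono fun X => ?_
  have hsec : MeasurableSet (Prod.mk X ⁻¹' (A.run S' ⁻¹' E)) := measurable_prodMk_left hm'
  have hpre : Prod.mk X ⁻¹' (A.run S ⁻¹' E)
      = (fun Y j => Y j + u X j) ⁻¹' (Prod.mk X ⁻¹' (A.run S' ⁻¹' E)) := by
    ext Y
    simp only [Set.mem_preimage, hrun]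
  have hprob : ∀ j, IsProbabilityMeasure ((laplaceMeasure 1).map fun y => y + u X j) := fun j =>
    Measure.isProbabilityMeasure_map (by fun_prop)
  rw [hpre, ← Measure.map_apply (by fun_prop) hsec,
    Measure.pi_map_pi (f := fun j y => y + u X j) fun j => by fun_prop]
  refine (measure_pi_le_smul_pi fun j => map_add_laplaceMeasure_one_le (u X j)) _ |>.trans ?_
  rw [Measure.smul_apply, ENNReal.smul_def, smul_eq_mul]
  gcongr
  rw [← Real.toNNReal_prod_of_nonneg fun _ _ => by positivity, ← Real.exp_sum]
  refine ENNReal.ofReal_le_ofReal (Real.exp_le_exp.2 ?_)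
  calc ∑ j, |u X j| ≤ ∑ _j : Fin r, α := Finset.sum_le_sum fun j _ => hu X j
    _ = α * r := by simp [mul_comm]

end NoisySketch

/-! ### Accuracy -/

/-- $\log Z\le Z/2$ gives $p\log Z\le\varepsilon/2$, and $e^x\le1+x+x^2$ at $x=\varepsilon/2$ leaves
$\frac34\varepsilon$. The remaining slack pays for the sampling error $\varepsilon/8$. -/
theorem rpow_le_one_add {p ε Z : ℝ} (hp : 0 < p) (hpZ : p < ε / Z) (hε1 : ε < 1) (hZ1 : 1 ≤ Z) :
    Z ^ p ≤ 1 + 3 / 4 * ε := by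
  have hZ : 0 < Z := by linarith
  have hlog : Real.log Z ≤ Z / 2 := by
    have h1 := Real.log_le_sub_one_of_pos (show 0 < Z / 2 by positivity)
    rw [Real.log_div hZ.ne' two_ne_zero] at h1
    linarith [Real.log_two_lt_d9]
  have hpl : p * Real.log Z ≤ ε / 2 := by
    calc p * Real.log Z ≤ ε / Z * (Z / 2) := by
          have := Real.log_nonneg hZ1
          gcongr
          exact (hp.trans hpZ).le
      _ = ε / 2 := by field_simp
  have hε : 0 < ε := by
    by_contra! h
    linarith [div_nonpos_of_nonpos_of_nonneg h hZ.le]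
  calc Z ^ p = Real.exp (p * Real.log Z) := by rw [Real.rpow_def_of_pos hZ, mul_comm]
    _ ≤ Real.exp (ε / 2) := by gcongr
    _ ≤ 1 + 3 / 4 * ε := by
      have := Real.abs_exp_sub_one_sub_id_le (x := ε / 2) (by rw [abs_of_pos] <;> linarith)
      nlinarith [(abs_le.1 this).2]

namespace UpdateStream

variable {U : Type*} [DecidableEq U] [Fintype U]

theorem distinctCount_eq_sum (S : UpdateStream U) :
    (S.distinctCount : ℝ) = ∑ i, if S.stateVec i ≠ 0 then 1 else 0 := by
  rw [distinctCount, Finset.card_filter]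
  push_cast
  rfl

theorem distinctCount_le_sum_rpow (S : UpdateStream U) {p : ℝ} (hp : 0 < p) :
    (S.distinctCount : ℝ) ≤ ∑ i, |(S.stateVec i : ℝ)| ^ p := by
  rw [distinctCount_eq_sum]
  refine Finset.sum_le_sum fun i _ => ?_
  split_ifs with h
  · refine Real.one_le_rpow ?_ hp.le
    exact_mod_cast Int.one_le_abs h
  · positivity

theorem BoundedBy.sum_rpow_le {S : UpdateStream U} {p ε Z : ℝ} (hS : S.BoundedBy Z) (hp : 0 < p)
    (hpZ : p < ε / Z) (hε1 : ε < 1) :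
    ∑ i, |(S.stateVec i : ℝ)| ^ p ≤ (1 + 3 / 4 * ε) * S.distinctCount := by
  rw [distinctCount_eq_sum, Finset.mul_sum]
  refine Finset.sum_le_sum fun i _ => ?_
  split_ifs with h
  · rw [mul_one]
    have h1 : (1 : ℝ) ≤ |(S.stateVec i : ℝ)| := by exact_mod_cast Int.one_le_abs h
    exact (Real.rpow_le_rpow (abs_nonneg _) (hS i).le hp.le).trans
      (rpow_le_one_add hp hpZ hε1 (h1.trans (hS i).le))
  · rw [not_not] at h
    simp [h, Real.zero_rpow hp.ne']

end UpdateStream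

open Set in
/-- With high probability the median of `|z_j| ^ p` over independent copies `z_j` of
`F ^ (1 / p) * X₀` is close to `F` times the median of `|X₀| ^ p`. -/
theorem IsPStable.measureReal_pi_median_le {p ε F : ℝ} {ν : Measure ℝ} [IsProbabilityMeasure ν]
    (hp : 0 < p) (hp1 : p < 1) (h : IsPStable p ν) (hν : ν ≠ Measure.dirac 0) (hε : 0 < ε)
    (hε1 : ε < 1) (hF : 0 ≤ F) {r : ℕ} (hr : 0 < r) :
    (Measure.pi fun _ : Fin r => ν.map fun y => F ^ (1 / p) * y).real
        {z | ¬ ((1 - ε / 8) * (F * absPowMedian p ν) ≤ sampleMedian (fun j => |z j| ^ p) ∧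
          sampleMedian (fun j => |z j| ^ p) ≤ (1 + ε / 8) * (F * absPowMedian p ν))} ≤
      2 * Real.exp (-(2 * r * (stableDensityBound / 18 * ε) ^ 2)) := by
  classical
  obtain ⟨-, hb⟩ := h.absPowMedian_bounds hp hp1 hν
  obtain ⟨hup, hlo⟩ := hb ε hε hε1
  set m := absPowMedian p ν
  have hθ : 0 ≤ stableDensityBound / 18 * ε := by
    have := stableDensityBound_pos
    positivity
  have hcont : Continuous fun x : ℝ => |x| ^ p :=
    (Real.continuous_rpow_const hp.le).comp continuous_abs
  have : IsProbabilityMeasure (ν.map fun y => F ^ (1 / p) * y) :=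
    Measure.isProbabilityMeasure_map (by fun_prop)
  have hscale : ∀ y, |F ^ (1 / p) * y| ^ p = F * |y| ^ p := fun y => by
    rw [abs_mul, abs_of_nonneg (by positivity), Real.mul_rpow (by positivity) (abs_nonneg y),
      one_div, Real.rpow_inv_rpow hF hp.ne']
  have hB1 : MeasurableSet {z : ℝ | (1 + ε / 8) * (F * m) < |z| ^ p} :=
    measurableSet_lt measurable_const hcont.measurable
  have hB2 : MeasurableSet {z : ℝ | |z| ^ p < (1 - ε / 8) * (F * m)} :=
    measurableSet_lt hcont.measurable measurable_const
  have hq1 : (ν.map fun y => F ^ (1 / p) * y).real {z : ℝ | (1 + ε / 8) * (F * m) < |z| ^ p}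
      ≤ 1 / 2 - stableDensityBound / 18 * ε := by
    rw [map_measureReal_apply (by fun_prop) hB1]
    refine (measureReal_mono fun y hy => ?_).trans hup
    have hy : (1 + ε / 8) * (F * m) < |F ^ (1 / p) * y| ^ p := hy
    rw [hscale, mul_left_comm] at hy
    exact lt_of_mul_lt_mul_left hy hF
  have hq2 : (ν.map fun y => F ^ (1 / p) * y).real {z : ℝ | |z| ^ p < (1 - ε / 8) * (F * m)}
      ≤ 1 / 2 - stableDensityBound / 18 * ε := by
    rw [map_measureReal_apply (by fun_prop) hB2]
    refine (measureReal_mono fun y hy => ?_).trans hlo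
    have hy : |F ^ (1 / p) * y| ^ p < (1 - ε / 8) * (F * m) := hy
    rw [hscale, mul_left_comm] at hy
    exact lt_of_mul_lt_mul_left hy hF
  have h1 := measureReal_pi_half_le_card_le hr hB1 hθ hq1
  have h2 := measureReal_pi_half_le_card_le hr hB2 hθ hq2
  rw [two_mul]
  refine le_trans ?_ (add_le_add h1 h2)
  refine le_trans (measureReal_mono fun z hz => ?_) (measureReal_union_le _ _)
  have hz : ¬ (_ ∧ _) := hz
  rw [not_and_or, not_le, not_le] at hz
  -- A sample median off on either side puts at least half of the samples in the corresponding bad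
  -- set, whatever the parity of $r$.
  rcases hz with hz | hz
  · right
    have := (sampleMedian_iff_card hr _ (· < (1 - ε / 8) * (F * m))
      fun _ _ h h' => h.trans_lt h').1 hz
    change (r : ℝ) / 2 ≤ _
    rw [div_le_iff₀ two_pos]
    norm_cast
    refine le_trans (by omega) (Nat.mul_le_mul_right 2 (Nat.succ_le_of_lt this))
  · left
    rw [← not_le, sampleMedian_le_iff hr, not_lt] at hz
    change (r : ℝ) / 2 ≤ _
    rw [div_le_iff₀ two_pos]
    norm_cast
    have hcard := Finset.card_filter_add_card_filter_not (s := Finset.univ)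
      (fun j : Fin r => |z j| ^ p ≤ (1 + ε / 8) * (F * m))
    simp only [not_le, Finset.card_univ, Fintype.card_fin] at hcard
    change r ≤ (Finset.univ.filter fun j => (1 + ε / 8) * (F * m) < |z j| ^ p).card * 2
    omega

theorem noiseBound_mul_le {p α δ W : ℝ} {U : Type*} {r : ℕ} (X : U → Fin r → ℝ) {Z ε : ℝ}
    {B : ℝ} (hB : 0 ≤ B) (hp : 0 < p) (hp1 : p < 1) (hZ : 0 < Z) (hα : 0 < α) (hpZ : p < ε / Z)
    (hε1 : ε < 1) (hW : 0 ≤ W) (hWZ : W ≤ 2 * Z) (hδ : 0 < δ) (hδ1 : δ < 1) (hr : 0 < r) :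
    noiseBound α δ p W X * B ≤
      4 * (1 + ε) * (B * maxColNorm X ^ p) * (r * Real.log (1 / δ) / (α * r)) ^ p := by
  have hε : 0 < ε := by
    by_contra! h
    linarith [div_nonpos_of_nonpos_of_nonneg h hZ.le]
  have hL : 0 ≤ Real.log (1 / δ) := Real.log_nonneg ((one_le_div hδ).2 hδ1.le)
  have hM := maxColNorm_nonneg X
  have hr' : (0 : ℝ) < r := by exact_mod_cast hr
  have e1 : (r : ℝ) * Real.log (1 / δ) / (α * r) = Real.log (1 / δ) / α := by field_simp
  have e2 : noiseBound α δ p W X =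
      (2 * W) ^ p * maxColNorm X ^ p * (Real.log (1 / δ) / α) ^ p := by
    rw [noiseBound, ← Real.mul_rpow (by positivity) hM, ← Real.mul_rpow (by positivity)
      (by positivity)]
    congr 1
    ring
  -- $Z$ may be below $1$, where `rpow_le_one_add` does not apply but $Z^p\le1$.
  have hZp : Z ^ p ≤ 1 + ε := by
    rcases le_or_gt Z 1 with h | h
    · linarith [Real.rpow_le_one hZ.le h hp.le]
    · linarith [rpow_le_one_add hp hpZ hε1 h.le]
  have hW4 : (2 * W) ^ p ≤ 4 * (1 + ε) := by
    calc (2 * W) ^ p ≤ (4 * Z) ^ p := Real.rpow_le_rpow (by positivity) (by linarith) hp.le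
      _ = 4 ^ p * Z ^ p := Real.mul_rpow (by norm_num) hZ.le
      _ ≤ 4 * (1 + ε) := by
        gcongr
        simpa using Real.rpow_le_rpow_of_exponent_le (show (1 : ℝ) ≤ 4 by norm_num) hp1.le
  rw [e1, e2]
  calc (2 * W) ^ p * maxColNorm X ^ p * (Real.log (1 / δ) / α) ^ p * B
      = (2 * W) ^ p * (B * maxColNorm X ^ p) * (Real.log (1 / δ) / α) ^ p := by ring
    _ ≤ _ := by gcongr

/-- $y^p\le\max(1,y)$ for $0<p<1$ and $y\ge0$; the summand $1$ in each factor absorbs the case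
$y\le1$. -/
theorem rpow_le_polylog {r K l L α p : ℝ} {k : ℕ} (hp : 0 < p) (hp1 : p < 1) (hr : 0 < r)
    (hα : 0 < α) (hL : 0 ≤ L) (hl : 0 ≤ l) (hK : 0 ≤ K) (hrK : r ≤ K * (1 + l) ^ k) :
    (r * L / (α * r)) ^ p ≤ (1 + K) * (1 + l) ^ k * (1 + L) * (1 + 1 / (α * r)) := by
  have hy : 0 ≤ r * L / (α * r) := by positivity
  have hlk : 1 ≤ (1 + l) ^ k := one_le_pow₀ (by linarith)
  have hα' : 0 ≤ 1 / (α * r) := by positivity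
  rcases le_total (r * L / (α * r)) 1 with h | h
  · refine (Real.rpow_le_one hy h hp.le).trans ?_
    calc (1 : ℝ) = 1 * 1 * 1 * 1 := by norm_num
      _ ≤ _ := by gcongr <;> linarith
  · calc (r * L / (α * r)) ^ p ≤ (r * L / (α * r)) ^ (1 : ℝ) :=
          Real.rpow_le_rpow_of_exponent_le h hp1.le
      _ = r * L * (1 / (α * r)) := by rw [Real.rpow_one]; ring
      _ ≤ (1 + K) * (1 + l) ^ k * (1 + L) * (1 + 1 / (α * r)) := by
          gcongr
          · refine hrK.trans ?_
            gcongr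
            linarith
          · linarith
          · linarith

section NoisySketch

variable {U : Type*} [Fintype U] {r : ℕ}

/-- Small noise and an accurate median of the noiseless sketches give an accurate output. -/
theorem noisySketch_result_bounds [DecidableEq U] {α δ p W ε : ℝ} {ν : Measure ℝ} (hp : 0 < p) (hp1 : p < 1)
    (hα : 0 < α) (hW : 0 ≤ W) (hε : 0 < ε) (hε1 : ε < 1) (hr : 0 < r)
    (hm : 0 < absPowMedian p ν) (S : UpdateStream U) {F : ℝ} (hF1 : S.distinctCount ≤ F)
    (hF2 : F ≤ (1 + 3 / 4 * ε) * S.distinctCount) (ω : SketchCoins U r)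
    (hY : ∀ j, |ω.2 j| ≤ Real.log (1 / δ))
    (hlo : (1 - ε / 8) * (F * absPowMedian p ν) ≤
      sampleMedian (fun j => |∑ i, (S.stateVec i : ℝ) * ω.1 i j| ^ p))
    (hup : sampleMedian (fun j => |∑ i, (S.stateVec i : ℝ) * ω.1 i j| ^ p) ≤
      (1 + ε / 8) * (F * absPowMedian p ν)) :
    (1 - ε) * S.distinctCount - noiseBound α δ p W ω.1 * scaleFactor p ν
        ≤ (noisySketch U r α p W ν).result S ω ∧
      (noisySketch U r α p W ν).result S ω
        ≤ (1 + ε) * S.distinctCount + noiseBound α δ p W ω.1 * scaleFactor p ν := by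
  set A := noisySketch U r α p W ν
  set z : Fin r → ℝ := fun j => ∑ i, (S.stateVec i : ℝ) * ω.1 i j
  set m := absPowMedian p ν
  have hB : scaleFactor p ν = 1 / m := rfl
  have hD : (0 : ℝ) ≤ S.distinctCount := Nat.cast_nonneg _
  set D : ℝ := (S.distinctCount : ℝ)
  set ξ := noiseBound α δ p W ω.1
  have hc : ∀ j, A.memory S ω j = 2 * W * colNorm ω.1 j / α * ω.2 j + z j :=
    noisySketch_memory α p W ν S ω
  have hnoise : ∀ j, |2 * W * colNorm ω.1 j / α * ω.2 j| ^ p ≤ ξ := fun j => by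
    refine Real.rpow_le_rpow (abs_nonneg _) ?_ hp.le
    have h0 := colNorm_nonneg ω.1 j
    have h1 : 0 ≤ 2 * W * colNorm ω.1 j / α := by positivity
    rw [abs_mul, abs_of_nonneg h1]
    have := maxColNorm_nonneg ω.1
    gcongr
    · exact colNorm_le_maxColNorm ω.1 j
    · exact hY j
  have hres : A.result S ω = sampleMedian (fun j => |A.memory S ω j| ^ p) * (1 / m) := rfl
  have h1 : sampleMedian (fun j => |A.memory S ω j| ^ p)
      ≤ sampleMedian (fun j => |z j| ^ p) + ξ := by
    refine sampleMedian_le_add hr fun j => ?_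
    calc |A.memory S ω j| ^ p
        ≤ (|z j| + |2 * W * colNorm ω.1 j / α * ω.2 j|) ^ p := by
          refine Real.rpow_le_rpow (abs_nonneg _) ?_ hp.le
          rw [hc, add_comm]
          exact abs_add_le _ _
      _ ≤ _ := Real.rpow_add_le_add_rpow (abs_nonneg _) (abs_nonneg _) hp.le hp1.le
      _ ≤ _ := by gcongr; exact hnoise j
  have h2 : sampleMedian (fun j => |z j| ^ p)
      ≤ sampleMedian (fun j => |A.memory S ω j| ^ p) + ξ := by
    refine sampleMedian_le_add hr fun j => ?_
    calc |z j| ^ p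
        ≤ (|A.memory S ω j| + |2 * W * colNorm ω.1 j / α * ω.2 j|) ^ p := by
          refine Real.rpow_le_rpow (abs_nonneg _) ?_ hp.le
          rw [show z j = A.memory S ω j - 2 * W * colNorm ω.1 j / α * ω.2 j by rw [hc]; ring]
          exact abs_sub _ _
      _ ≤ _ := Real.rpow_add_le_add_rpow (abs_nonneg _) (abs_nonneg _) hp.le hp1.le
      _ ≤ _ := by gcongr; exact hnoise j
  rw [hB, hres, mul_one_div, mul_one_div]
  constructor
  · rw [sub_le_iff_le_add, ← add_div, le_div_iff₀ hm]
    have : (1 - ε) * D ≤ (1 - ε / 8) * F := by nlinarith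
    nlinarith [mul_le_mul_of_nonneg_right this hm.le]
  · rw [← sub_le_iff_le_add, ← sub_div, div_le_iff₀ hm]
    have : (1 + ε / 8) * F ≤ (1 + ε) * D := by
      calc (1 + ε / 8) * F ≤ (1 + ε / 8) * ((1 + 3 / 4 * ε) * D) := by gcongr
        _ ≤ (1 + ε) * D := by nlinarith [mul_nonneg hD (mul_nonneg hε.le (sub_nonneg.2 hε1.le))]
    nlinarith [mul_le_mul_of_nonneg_right this hm.le]

/-- Only an inequality is claimed: `Measure.le_map_apply` then allows arbitrary sets $T$. -/
theorem sketchLaw_real_fst_le {ν : Measure ℝ} [IsProbabilityMeasure ν] (a : U → ℝ) {p : ℝ}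
    (h : IsPStable p ν) (T : Set (Fin r → ℝ)) :
    (sketchLaw U r ν).real {ω | (fun j => ∑ i, a i * ω.1 i j) ∈ T} ≤
      (Measure.pi fun _ : Fin r => ν.map fun y => (∑ i, |a i| ^ p) ^ (1 / p) * y).real T := by
  have : IsProbabilityMeasure (ν.map fun y => (∑ i, |a i| ^ p) ^ (1 / p) * y) :=
    Measure.isProbabilityMeasure_map (by fun_prop)
  have hz : Measurable fun (X : U → Fin r → ℝ) j => ∑ i, a i * X i j :=
    measurable_pi_lambda _ fun j => Finset.measurable_sum _ fun i _ => by fun_prop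
  refine ENNReal.toReal_mono (measure_ne_top _ _) ?_
  rw [← h.map_sketch a r]
  refine le_trans ?_ (Measure.le_map_apply hz.aemeasurable T)
  refine (Measure.le_map_apply measurable_fst.aemeasurable
    ((fun (X : U → Fin r → ℝ) j => ∑ i, a i * X i j) ⁻¹' T)).trans ?_
  rw [sketchLaw, measurePreserving_fst.map_eq]

theorem sketchLaw_real_noise_le {ν : Measure ℝ} [IsProbabilityMeasure ν] {L : ℝ} (hL : 0 ≤ L) :
    (sketchLaw U r ν).real {ω | ¬ ∀ j, |ω.2 j| ≤ L} ≤ r * Real.exp (-L) := by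
  have h1 : ∀ j : Fin r, (sketchLaw U r ν).real {ω | L < |ω.2 j|} ≤ Real.exp (-L) := fun j => by
    refine le_trans ?_ (laplaceMeasure_one_real_abs_gt_le hL)
    refine ENNReal.toReal_mono (measure_ne_top _ _) ?_
    have hmp : MeasurePreserving (fun ω : SketchCoins U r => ω.2 j) (sketchLaw U r ν)
        (laplaceMeasure 1) :=
      (measurePreserving_eval (fun _ : Fin r => laplaceMeasure 1) j).comp measurePreserving_snd
    rw [← hmp.map_eq]
    exact Measure.le_map_apply hmp.measurable.aemeasurable _
  have : IsProbabilityMeasure (sketchLaw U r ν) := by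
    unfold sketchLaw
    infer_instance
  calc (sketchLaw U r ν).real {ω | ¬ ∀ j, |ω.2 j| ≤ L}
      ≤ (sketchLaw U r ν).real (⋃ j, {ω | L < |ω.2 j|}) := measureReal_mono fun ω hω => by
        simpa using hω
    _ ≤ ∑ j : Fin r, (sketchLaw U r ν).real {ω | L < |ω.2 j|} := measureReal_iUnion_fintype_le _
    _ ≤ ∑ _j : Fin r, Real.exp (-L) := Finset.sum_le_sum fun j _ => h1 j
    _ = _ := by simp

/-- Accuracy of the noisy sketch. -/
theorem noisySketch_accuracy [DecidableEq U] {ε δ α p Z W : ℝ} {ν : Measure ℝ} [IsProbabilityMeasure ν]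
    (hε : 0 < ε) (hε1 : ε < 1) (hδ : 0 < δ) (hδ1 : δ < 1) (hα : 0 < α) (hp : 0 < p) (hp1 : p < 1)
    (hpZ : p < ε / Z) (hW : 0 ≤ W) (h : IsPStable p ν) (hν : ν ≠ Measure.dirac 0) (hr : 0 < r)
    (hrC : (18 / stableDensityBound) ^ 2 * (1 / ε ^ 2 * Real.log (1 / δ)) ≤ r)
    {S : UpdateStream U} (hS : S.BoundedBy Z) :
    1 - (r + 1) * δ ≤ (sketchLaw U r ν).real {ω |
      (1 - ε) * S.distinctCount - noiseBound α δ p W ω.1 * scaleFactor p ν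
          ≤ (noisySketch U r α p W ν).result S ω ∧
        (noisySketch U r α p W ν).result S ω
          ≤ (1 + ε) * S.distinctCount + noiseBound α δ p W ω.1 * scaleFactor p ν} := by
  have hr1 : (1 : ℝ) ≤ r := by exact_mod_cast hr
  -- For $\delta\ge1/2$ and $r\ge1$ the claimed probability is at most $0$. Otherwise the two-sided
  -- Hoeffding bound $2\delta^2$ is at most $\delta$.
  rcases le_or_gt (1 / 2) δ with hδ2 | hδ2
  · refine le_trans ?_ measureReal_nonneg
    nlinarith
  have : IsProbabilityMeasure (sketchLaw U r ν) := by
    unfold sketchLaw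
    infer_instance
  have hL : 0 ≤ Real.log (1 / δ) := Real.log_nonneg ((one_le_div hδ).2 hδ1.le)
  have hexpL : Real.exp (-Real.log (1 / δ)) = δ := by
    rw [one_div, Real.log_inv, neg_neg, Real.exp_log hδ]
  set a : U → ℝ := fun i => S.stateVec i
  set F := ∑ i, |a i| ^ p with hFdef
  have hF : 0 ≤ F := Finset.sum_nonneg fun _ _ => by positivity
  set T : Set (Fin r → ℝ) :=
    {z | ¬ ((1 - ε / 8) * (F * absPowMedian p ν) ≤ sampleMedian (fun j => |z j| ^ p) ∧
      sampleMedian (fun j => |z j| ^ p) ≤ (1 + ε / 8) * (F * absPowMedian p ν))} with hT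
  have hbad1 := sketchLaw_real_noise_le (U := U) (r := r) (ν := ν) hL
  have hbad2 := (sketchLaw_real_fst_le (r := r) a h T).trans
    (h.measureReal_pi_median_le hp hp1 hν hε hε1 hF hr)
  rw [hexpL] at hbad1
  have hκ := stableDensityBound_pos
  have hexp : 2 * Real.exp (-(2 * r * (stableDensityBound / 18 * ε) ^ 2)) ≤ δ := by
    have h1 : Real.log (1 / δ) ≤ r * (stableDensityBound / 18 * ε) ^ 2 := by
      calc Real.log (1 / δ) = (18 / stableDensityBound) ^ 2 * (1 / ε ^ 2 * Real.log (1 / δ)) *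
            (stableDensityBound / 18 * ε) ^ 2 := by field_simp
        _ ≤ _ := by gcongr
    have h2 : Real.exp (-(2 * r * (stableDensityBound / 18 * ε) ^ 2)) ≤ δ * δ := by
      nth_rewrite 1 [← hexpL]
      nth_rewrite 2 [← hexpL]
      rw [← Real.exp_add]
      exact Real.exp_le_exp.2 (by linarith)
    nlinarith
  have hcompl : (sketchLaw U r ν).real
      ({ω | ¬ ∀ j, |ω.2 j| ≤ Real.log (1 / δ)} ∪ {ω | (fun j => ∑ i, a i * ω.1 i j) ∈ T})
      ≤ (r + 1) * δ := by
    refine (measureReal_union_le _ _).trans ?_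
    linarith
  obtain ⟨hm, -⟩ := h.absPowMedian_bounds hp hp1 hν
  have huniv : (sketchLaw U r ν).real Set.univ = 1 := probReal_univ
  set G := {ω : SketchCoins U r |
      (1 - ε) * S.distinctCount - noiseBound α δ p W ω.1 * scaleFactor p ν
          ≤ (noisySketch U r α p W ν).result S ω ∧
        (noisySketch U r α p W ν).result S ω
          ≤ (1 + ε) * S.distinctCount + noiseBound α δ p W ω.1 * scaleFactor p ν} with hG
  -- Covering the whole space and using subadditivity avoids measurability of the good event.
  have hcover : Set.univ ⊆ G ∪
      ({ω | ¬ ∀ j, |ω.2 j| ≤ Real.log (1 / δ)} ∪ {ω | (fun j => ∑ i, a i * ω.1 i j) ∈ T}) := by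
    intro ω _
    by_cases h1 : ∀ j, |ω.2 j| ≤ Real.log (1 / δ)
    · by_cases h2 : (fun j => ∑ i, a i * ω.1 i j) ∈ T
      · exact Or.inr (Or.inr h2)
      · have h2 := not_not.1 h2
        exact Or.inl (noisySketch_result_bounds hp hp1 hα hW hε hε1 hr hm S
          (S.distinctCount_le_sum_rpow hp) (hS.sum_rpow_le hp hpZ hε1) ω h1 h2.1 h2.2)
    · exact Or.inr (Or.inl h1)
  have := (measureReal_mono (μ := sketchLaw U r ν) hcover).trans (measureReal_union_le _ _)
  linarith

end NoisySketch

/-! ### Assembly of privacy, accuracy and error size -/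

theorem mainTheorem1 :
    ∃ C : ℝ, 0 < C ∧
      ∀ (U : Type*) [Fintype U] [DecidableEq U] (ε δ α p Z W : ℝ) (r : ℕ)
        (ν : Measure ℝ) [IsProbabilityMeasure ν],
        0 < ε → ε < 1 → 0 < δ → δ < 1 → 0 < α →
        0 < p → p < ε / Z → ε / Z < 1 →
        Z ≤ W → W ≤ 2 * Z →
        IsPStable p ν → ν ≠ Measure.dirac 0 →
        C * (1 / ε ^ 2 * Real.log (1 / δ)) ≤ r →
        -- pan-privacy in the turnstile model, for replaced updates of total at most `W`
        (noisySketch U r α p W ν).PanPrivate (α * r) (fun S S' =>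
          S.BoundedBy Z ∧ S'.BoundedBy Z ∧
            ∃ s : ℤ, UpdateStream.NeighborBy S S' s ∧ |(s : ℝ)| ≤ W) ∧
        -- pan-privacy in the turnstile model, for all neighbours, when `W = 2 Z`
        (W = 2 * Z → (noisySketch U r α p W ν).PanPrivate (α * r) (fun S S' =>
          S.BoundedBy Z ∧ S'.BoundedBy Z ∧ UpdateStream.Neighbor S S')) ∧
        -- pan-privacy in the cash register model, for all neighbours
        (noisySketch U r α p W ν).PanPrivate (α * r) (fun S S' =>
          S.BoundedBy Z ∧ S'.BoundedBy Z ∧ S.CashRegister ∧ S'.CashRegister ∧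
            UpdateStream.Neighbor S S') ∧
        -- accuracy with the additive error `ξ * B(p)`
        (∀ S : UpdateStream U, S.BoundedBy Z →
          1 - (r + 1) * δ ≤ (sketchLaw U r ν).real {ω |
            (1 - ε) * S.distinctCount - noiseBound α δ p W ω.1 * scaleFactor p ν
                ≤ (noisySketch U r α p W ν).result S ω ∧
              (noisySketch U r α p W ν).result S ω
                ≤ (1 + ε) * S.distinctCount + noiseBound α δ p W ω.1 * scaleFactor p ν}) ∧
        -- the size of `ξ * B(p)` in terms of `α' = α * r`
        (∀ X : U → Fin r → ℝ,
          noiseBound α δ p W X * scaleFactor p ν ≤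
            4 * (1 + ε) * (scaleFactor p ν * maxColNorm X ^ p) *
              (r * Real.log (1 / δ) / (α * r)) ^ p) ∧
        -- accuracy with polylogarithmic additive error when `r` is polylogarithmic in `m = |U|`
        (∀ (K : ℝ) (k : ℕ), 0 ≤ K → r ≤ K * (1 + Real.log (Fintype.card U)) ^ k →
          ∀ S : UpdateStream U, S.BoundedBy Z →
            1 - (r + 1) * δ ≤ (sketchLaw U r ν).real {ω |
              |(noisySketch U r α p W ν).result S ω - S.distinctCount| ≤
                ε * S.distinctCount +
                  4 * (1 + K) * (scaleFactor p ν * maxColNorm ω.1 ^ p) * (1 + ε) *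
                    (1 + Real.log (Fintype.card U)) ^ k * (1 + Real.log (1 / δ)) *
                    (1 + 1 / (α * r))}) := by
  have hκ := stableDensityBound_pos
  -- The inverse square of the Hoeffding gap per unit of $\varepsilon$, so that
  -- $r\theta^2\ge\log(1/\delta)$ for $\theta=\kappa\varepsilon/18$.
  refine ⟨(18 / stableDensityBound) ^ 2, by positivity, ?_⟩
  intro U _ _ ε δ α p Z W r ν _ hε hε1 hδ hδ1 hα hp hpZ hεZ hZW hWZ h hν hrC
  have hZ : 0 < Z := by
    by_contra! hle
    linarith [div_nonpos_of_nonneg_of_nonpos hε.le hle]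
  have hW : 0 < W := hZ.trans_le hZW
  have hp1 : p < 1 := hpZ.trans hεZ
  have hL : 0 < Real.log (1 / δ) := Real.log_pos ((one_lt_div hδ).2 hδ1)
  have hr : 0 < r := by
    have : (0 : ℝ) < r := lt_of_lt_of_le (by positivity) hrC
    exact_mod_cast this
  have hpriv := panPrivate_noisySketch (U := U) (r := r) (p := p) hα hW ν
  have hacc := fun (S : UpdateStream U) (hS : S.BoundedBy Z) => noisySketch_accuracy hε hε1 hδ hδ1
    hα hp hp1 hpZ hW.le h hν hr hrC hS
  have hB : 0 ≤ scaleFactor p ν := (one_div_pos.2 (h.absPowMedian_bounds hp hp1 hν).1).le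
  have hnoise := fun X : U → Fin r → ℝ =>
    noiseBound_mul_le X hB hp hp1 hZ hα hpZ hε1 hW.le hWZ hδ hδ1 hr
  refine ⟨fun S S' hN => hpriv S S' hN.2.2, ?_, ?_, hacc, hnoise, ?_⟩
  · rintro rfl S S' ⟨hS, hS', s, hs⟩
    exact hpriv S S' ⟨s, hs, (hs.abs_lt_two_mul hS hS').le⟩
  · rintro S S' ⟨hS, -, hcr, -, s, hs⟩
    exact hpriv S S' ⟨s, hs, (hs.abs_lt_of_cashRegister hS hcr).le.trans hZW⟩
  · intro K k hK hrK S hS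
    refine (hacc S hS).trans ?_
    have : IsProbabilityMeasure (sketchLaw U r ν) := by
      unfold sketchLaw
      infer_instance
    refine measureReal_mono fun ω hω => ?_
    have hpoly := rpow_le_polylog hp hp1 (by exact_mod_cast hr : (0 : ℝ) < r) hα hL.le
      (Real.log_natCast_nonneg (Fintype.card U)) hK hrK
    have hc : 0 ≤ 4 * (1 + ε) * (scaleFactor p ν * maxColNorm ω.1 ^ p) := by
      have := Real.rpow_nonneg (maxColNorm_nonneg ω.1) p
      positivity
    have hξ := (hnoise ω.1).trans (mul_le_mul_of_nonneg_left hpoly hc)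
    obtain ⟨h1, h2⟩ := hω
    rw [Set.mem_ofPred_eq, abs_le]
    constructor <;> linarith
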